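/- **Theorem (Equivalence of ensembles in two dimensions).** Let $0<q<1$, $q=e^{-\eta}$. For integers $L\ge 1$, $n\ge 0$ let $\Lambda(L,n)=\{-\frac{L-1}2,-\frac{L-3}2,\dots,\frac{L-1}2\}\times\{1,\dots,n\}$, with a spin $\frac12$ at every site $(l,j)$, and let $\mathcal A_{\Lambda(L,n)}$ be the algebra of all operators on $(\mathbb C^2)^{\otimes\Lambda(L,n)}$. Put $$\Psi_0(L,n,M)=\sum_{\substack{m(l,j)\in\{\pm1/2\}\\ \sum m(l,j)=M}} q^{\sum_{(l,j)}(\frac12|l|-m(l,j)l)}\bigotimes_{(l,j)}|m(l,j)\rangle,\qquad \Psi^{GC}_0(L,n,r)=\sum_{M=-Ln/2}^{Ln/2} r^{M}\,\Psi_0(L,n,M)$$ ($M$ in steps of $1$). For $n_0<n$ and $X\in\mathcal A_{\Lambda(L,n_0)}$ let $$\langle X\rangle^{can}_{(L,n,M)}=\frac{\langle\Psi_0(L,n,M),(X\otimes 1)\Psi_0(L,n,M)\rangle}{\|\Psi_0(L,n,M)\|^2},\qquad \langle X\rangle^{GC}_{(L,n_0,r)}=\frac{\langle\Psi^{GC}_0(L,n_0,r),X\Psi^{GC}_0(L,n_0,r)\rangle}{\|\Psi^{GC}_0(L,n_0,r)\|^2}.$$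 With $l$ running over $\{-\frac{L-1}2,\dots,\frac{L-1}2\}$ let $F_L(z)=\prod_l(zq^{|l|-l}+z^{-1}q^{|l|+l})$, and let $\phi_L:(-\frac L2,\frac L2)\to\mathbb R$ be the inverse of $\phi_L^{-1}(t)=\frac12\sum_l\frac{\sinh t}{\cosh t+\cosh(2\eta l)}$. For $0<\epsilon<\frac14$ put $$\varepsilon_{upper}(L,n,m)=\frac{n^{-1+2\epsilon}}{6-n^{-1+2\epsilon}}+\sqrt{\frac{2\pi n}{\phi_L'(m)}}\exp\Big[\frac{-2n^{2\epsilon}(1-\frac16n^{-1+2\epsilon})^2}{\phi_L'(m)}\Big],$$ $$\varepsilon_{lower}(L,n,m)=n^{-1+2\epsilon}+\frac{4n^{-1+4\epsilon}(m\phi_L'(m))^2}{(1-2n^{-1+2\epsilon})^4}+\Big(1+\sqrt{\frac{2\pi n}{\phi_L'(m)}}\Big)\exp\Big[\frac{-2n^{2\epsilon}(1-\frac16n^{-1+2\epsilon})^2}{\phi_L'(m)}\Big].$$ Let $0\le n_0<n$, let $X\in\mathcal A_{\Lambda(L,n_0)}$ commute with the total third spin component $\sum_{x\in\Lambda(L,n_0)}S^{(3)}_x$,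 let $m\in\{-\frac L2,-\frac L2+\frac1n,\dots,\frac L2\}$, $0<\epsilon<\frac14$, $0<\epsilon_2<\frac12$, and let $\mathcal D$ be the open ball (interval) $B\big(\frac{mn}{n-n_0};\frac{n_0n^{\epsilon_2}}{n-n_0}\big)$. Assume that the closed ball with the same centre and radius is contained in $(-\frac L2,\frac L2)$ (so that $|m|<\frac L2$ and the norms below are finite), put $t=\phi_L(m)$, and assume $e^{|t|}q^{2n^{\epsilon_2}}<1$ and $\varepsilon_{lower}(L,n,m)<1$. Then $$\Big|\langle X\rangle^{can}_{(L,n,mn)}-\langle X\rangle^{GC}_{(L,n_0,e^{t/2})}\Big|\le 2(\mathcal E_1+\mathcal E_2)\|X\|,$$ where $\|X\|$ is the operator norm, $(q^2;q^2)_\infty=\prod_{k\ge1}(1-q^{2k})$, $$\mathcal E_1=\frac{4}{1-e^{|t|}q^{2n^{\epsilon_2}}}\left[\frac{e^{|tn^{\epsilon_2}|}q^{n^{2\epsilon_2}}\sum_{k\in\mathbb Z}q^{k^2}}{F_L(e^{t/2})\,(q^2;q^2)_\infty}\right]^{n_0}$$ and $\mathcal E_2$ is the larger of $$\Big[1+\tfrac{n_0}{n-n_0}\Big]^{1/2}\Big[1+\tfrac{\|\phi_L''\|_{L^\infty(\mathcal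 D)}}{\phi_L'(m)}\tfrac{(|m|+n^{\epsilon_2})n_0}{n-n_0}\Big]^{1/2}\exp\Big[\tfrac12\|\phi_L'\|_{L^\infty(\mathcal D)}\tfrac{(|m|+n^{\epsilon_2})^2n_0^2}{n-n_0}\Big]\frac{1+\|\varepsilon_{upper}(L,n-n_0,\cdot)\|_{L^\infty(\mathcal D)}}{1-\varepsilon_{lower}(L,n,m)}-1$$ and $$1-\Big[1+\tfrac{n_0}{n-n_0}\Big]^{1/2}\Big[1-\tfrac{\|\phi_L''\|_{L^\infty(\mathcal D)}}{\phi_L'(m)}\tfrac{(|m|+n^{\epsilon_2})n_0}{n-n_0}\Big]^{1/2}\exp\Big[-\tfrac12\|\phi_L'\|_{L^\infty(\mathcal D)}\tfrac{(|m|+n^{\epsilon_2})^2n_0^2}{n-n_0}\Big]\frac{1-\|\varepsilon_{lower}(L,n-n_0,\cdot)\|_{L^\infty(\mathcal D)}}{1+\varepsilon_{upper}(L,n,m)}.$$ (The square root of a negative number is read as $0$, and a quotient with denominator $0$ as $0$.) -/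

import Mathlib

open MeasureTheory

noncomputable section

namespace XXZ

/-- The height of the `i`-th layer: the values are `-(L-1)/2, -(L-3)/2, …, (L-1)/2`. -/
def level (L : ℕ) (i : Fin L) : ℝ := (i : ℝ) - ((L : ℝ) - 1) / 2

/-- The sites of the cylinder `Λ(L,n)`: a layer and one of the `n` sticks. -/
abbrev Site (L n : ℕ) : Type := Fin L × Fin n

/-- Classical spin configurations on `Λ(L,n)`; `true` is spin up, `false` is spin down. -/
abbrev Config (L n : ℕ) : Type := Site L n → Bool

/-- The value `±1/2` of a classical spin. -/
def spin (b : Bool) : ℝ := if b then 1 / 2 else -(1 / 2)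

/-- Total third component of the spin of a configuration. -/
def magnetization {L n : ℕ} (σ : Config L n) : ℝ := ∑ x, spin (σ x)

/-- The space `(ℂ²)^{⊗ Λ(L,n)}`, with the configurations as orthonormal basis. -/
abbrev Hilb (L n : ℕ) : Type := EuclideanSpace ℂ (Config L n)

/-- The observable algebra of `Λ(L,n)`: all operators on the Hilbert space, with operator norm. -/
abbrev Obs (L n : ℕ) : Type := Hilb L n →L[ℂ] Hilb L n

/-- The total third spin component, which is diagonal in the configuration basis. -/
def totalSpin (L n : ℕ) : Obs L n :=
  Matrix.toEuclideanCLM (𝕜 := ℂ)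
    (Matrix.diagonal fun σ : Config L n => ((magnetization σ : ℝ) : ℂ))

open Classical in
/-- The canonical ground state with magnetization `M`. -/
def canState (q : ℝ) (L n : ℕ) (M : ℝ) : Hilb L n :=
  WithLp.toLp 2 fun σ =>
    if magnetization σ = M then
      ((q ^ (∑ x : Site L n, (|level L x.1| / 2 - spin (σ x) * level L x.1)) : ℝ) : ℂ)
    else 0

/-- The grand canonical ground state at activity `r`: the sum of `r ^ M` times the canonical
states, `M = -|Λ|/2, -|Λ|/2 + 1, …, |Λ|/2`, so that its squared norm is
`∑ r ^ (2 M) * Z(L,n,M) = F_L(r) ^ n`. -/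
def gcState (q : ℝ) (L n : ℕ) (r : ℝ) : Hilb L n :=
  ∑ k ∈ Finset.range (L * n + 1),
    ((r ^ ((k : ℝ) - (L * n : ℝ) / 2) : ℝ) : ℂ) • canState q L n ((k : ℝ) - (L * n : ℝ) / 2)

/-- Restriction of a configuration to the first `n₀` sticks. -/
def restrict {L n₀ n : ℕ} (h : n₀ ≤ n) (σ : Config L n) : Config L n₀ :=
  fun x => σ (x.1, Fin.castLE h x.2)

/-- The configuration equal to `τ` on the first `n₀` sticks and to `σ` on the others. -/
def glue {L n₀ n : ℕ} (τ : Config L n₀) (σ : Config L n) : Config L n :=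
  fun x => if h : (x.2 : ℕ) < n₀ then τ (x.1, ⟨x.2, h⟩) else σ x

/-- The inclusion `X ↦ X ⊗ 1` of the observables of `Λ(L,n₀)` into those of `Λ(L,n)`. -/
def ampliate {L n₀ n : ℕ} (h : n₀ ≤ n) (X : Obs L n₀) : Hilb L n →ₗ[ℂ] Hilb L n where
  toFun ψ := WithLp.toLp 2 fun σ => X (WithLp.toLp 2 fun τ => ψ (glue τ σ)) (restrict h σ)
  map_add' ψ φ := by
    ext σ
    have : (WithLp.toLp 2 fun τ : Config L n₀ => (ψ + φ) (glue τ σ))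
        = (WithLp.toLp 2 fun τ => ψ (glue τ σ)) + WithLp.toLp 2 fun τ => φ (glue τ σ) := by
      ext τ; simp
    change X _ (restrict h σ) = _
    rw [this, map_add]; rfl
  map_smul' c ψ := by
    ext σ
    have : (WithLp.toLp 2 fun τ : Config L n₀ => (c • ψ) (glue τ σ))
        = c • (WithLp.toLp 2 fun τ => ψ (glue τ σ)) := by
      ext τ; simp
    change X _ (restrict h σ) = _
    rw [this, map_smul]; rfl

/-- The expectation of `A` in the (not normalized) vector state `ψ`. -/
def expectation {L n : ℕ} (A : Hilb L n →ₗ[ℂ] Hilb L n) (ψ : Hilb L n) : ℂ :=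
  inner ℂ ψ (A ψ) / ((‖ψ‖ ^ 2 : ℝ) : ℂ)

/-- Canonical expectation in `Λ(L,n)`, at magnetization `M`, of an observable of `Λ(L,n₀)`. -/
def canExp (q : ℝ) {L n₀ n : ℕ} (h : n₀ ≤ n) (M : ℝ) (X : Obs L n₀) : ℂ :=
  expectation (ampliate h X) (canState q L n M)

/-- Grand canonical expectation in `Λ(L,n₀)` at activity `r`. -/
def gcExp (q : ℝ) {L n₀ : ℕ} (r : ℝ) (X : Obs L n₀) : ℂ :=
  expectation (X : Hilb L n₀ →ₗ[ℂ] Hilb L n₀) (gcState q L n₀ r)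

/-- The grand canonical partition function `F_L(z)` of one stick. -/
def F (q : ℝ) (L : ℕ) (z : ℝ) : ℝ :=
  ∏ i : Fin L, (z * q ^ (|level L i| - level L i) + z⁻¹ * q ^ (|level L i| + level L i))

/-- The function `φ_L⁻¹`, where `q = e^{-η}`, that is `η = -log q`. -/
def phiInv (q : ℝ) (L : ℕ) (t : ℝ) : ℝ :=
  1 / 2 * ∑ i : Fin L,
    Real.sinh t / (Real.cosh t + Real.cosh (2 * (-Real.log q) * level L i))

/-- The function `φ_L`, meant on the range `(-L/2, L/2)` of the injective function `phiInv`. -/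
def phi (q : ℝ) (L : ℕ) : ℝ → ℝ := Function.invFun (phiInv q L)

/-- The first derivative of `φ_L`. -/
def dphi (q : ℝ) (L : ℕ) : ℝ → ℝ := deriv (phi q L)

/-- The second derivative of `φ_L`. -/
def ddphi (q : ℝ) (L : ℕ) : ℝ → ℝ := deriv (dphi q L)

/-- The error `ε_upper(L,n,m)` of the upper activity bound, with parameter `ε`. -/
def epsUpper (q : ℝ) (L n : ℕ) (ε m : ℝ) : ℝ :=
  (n : ℝ) ^ (-1 + 2 * ε) / (6 - (n : ℝ) ^ (-1 + 2 * ε))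
    + Real.sqrt (2 * Real.pi * n / dphi q L m)
      * Real.exp (-2 * (n : ℝ) ^ (2 * ε) * (1 - 1 / 6 * (n : ℝ) ^ (-1 + 2 * ε)) ^ 2
          / dphi q L m)

/-- The error `ε_lower(L,n,m)` of the lower activity bound, with parameter `ε`. -/
def epsLower (q : ℝ) (L n : ℕ) (ε m : ℝ) : ℝ :=
  (n : ℝ) ^ (-1 + 2 * ε)
    + 4 * (n : ℝ) ^ (-1 + 4 * ε) * (m * dphi q L m) ^ 2
      / (1 - 2 * (n : ℝ) ^ (-1 + 2 * ε)) ^ 4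
    + (1 + Real.sqrt (2 * Real.pi * n / dphi q L m))
      * Real.exp (-2 * (n : ℝ) ^ (2 * ε) * (1 - 1 / 6 * (n : ℝ) ^ (-1 + 2 * ε)) ^ 2
          / dphi q L m)

/-- The norm of `L^∞(D)`, as a real number. -/
def supNorm (D : Set ℝ) (f : ℝ → ℝ) : ℝ := (eLpNorm f ⊤ (volume.restrict D)).toReal

/-- The centre `m n / (n - n₀)` of the ball `𝒟`. -/
def centerD (n₀ n : ℕ) (m : ℝ) : ℝ := m * n / ((n : ℝ) - n₀)

/-- The radius `n₀ n^{ε₂} / (n - n₀)` of the ball `𝒟`. -/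
def radiusD (n₀ n : ℕ) (ε₂ : ℝ) : ℝ := n₀ * (n : ℝ) ^ ε₂ / ((n : ℝ) - n₀)

/-- The first error `ℰ₁`, with `t = φ_L(m)`. -/
def E₁ (q : ℝ) (L n₀ n : ℕ) (m ε₂ : ℝ) : ℝ :=
  4 / (1 - Real.exp |phi q L m| * q ^ (2 * (n : ℝ) ^ ε₂))
    * (Real.exp |phi q L m * (n : ℝ) ^ ε₂| * q ^ ((n : ℝ) ^ (2 * ε₂)) * (∑' k : ℤ, q ^ (k ^ 2))
        / (F q L (Real.exp (phi q L m / 2)) * ∏' k : ℕ, (1 - q ^ (2 * (k + 1))))) ^ n₀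

/-- The second error `ℰ₂`. -/
def E₂ (q : ℝ) (L n₀ n : ℕ) (m ε ε₂ : ℝ) : ℝ :=
  let D : Set ℝ := Metric.ball (centerD n₀ n m) (radiusD n₀ n ε₂)
  let N : ℝ := (n : ℝ) ^ ε₂
  let d : ℝ := (n : ℝ) - n₀
  max
    (Real.sqrt (1 + n₀ / d)
      * Real.sqrt (1 + supNorm D (ddphi q L) / dphi q L m * ((|m| + N) * n₀ / d))
      * Real.exp (1 / 2 * supNorm D (dphi q L) * ((|m| + N) ^ 2 * (n₀ : ℝ) ^ 2 / d))
      * ((1 + supNorm D (epsUpper q L (n - n₀) ε)) / (1 - epsLower q L n ε m)) - 1)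
    (1 - Real.sqrt (1 + n₀ / d)
      * Real.sqrt (1 - supNorm D (ddphi q L) / dphi q L m * ((|m| + N) * n₀ / d))
      * Real.exp (-(1 / 2) * supNorm D (dphi q L) * ((|m| + N) ^ 2 * (n₀ : ℝ) ^ 2 / d))
      * ((1 - supNorm D (epsLower q L (n - n₀) ε)) / (1 + epsUpper q L n ε m)))

end XXZ

end

noncomputable section

namespace XXZ

/-! ### Gaussian integrals -/

/-! Weight a configuration by `e^{tM}`, with `t = φ_L(m)`. The squared amplitudes then factor over
the sites, and the canonical norm becomes `F_L(e^{t/2})^n` times the probability that independent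
spins of means `polarization / 2` have sum `M` (`canNorm_mul_exp`). The choice of `t` makes `M = mn`
the mean of this sum.

Both expectations of `X` are averages of the same numbers `⟨Ψ_K, XΨ_K⟩`, over the magnetization `K`
inside `Λ(L,n₀)`. The canonical weight of `K`, divided by the grand canonical one, is the ratio of
the probability of `M - K` on the other `n - n₀` sticks to that of `M` on all `n`. Both families of
weights are normalized, so a one-sided bound `1 + E` on this ratio suffices and costs `2E‖X‖`
(`norm_weighted_mean_sub_le`).

The numerator is at most `(1 + 1/(2V')) / √(2πV')` for every `K` (`spinLaw_upper`), so no truncation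
in `K` is needed and `ℰ₁` enters only through its sign. The denominator, taken at the mean, is at
least `(1 - ε_lower) / √(2πV)` (`spinLaw_lower`). Both bounds come from Fourier inversion. The
quotient of the variances gives `1 + n₀/(n - n₀)`. The correction `1/(2V')` is absorbed by the
exponential in `ℰ₂` (`one_add_le_exp_supNorm`), because the variance of a stick is a 1-Lipschitz
function of its magnetization. Only the first of the two quantities in `ℰ₂` is used. -/

open Real in
theorem integral_sq_mul_gaussian {c : ℝ} (hc : 0 < c) :
    ∫ x : ℝ, x ^ 2 * exp (-(c ^ 2) * x ^ 2) = √π / (2 * c ^ 3) := by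
  have h := integral_rpow_mul_exp_neg_mul_rpow (p := 2) (q := 2) (b := c ^ 2)
    (by norm_num) (by norm_num) (by positivity)
  have h1 : ∫ x : ℝ, x ^ 2 * exp (-(c ^ 2) * x ^ 2)
      = 2 * ∫ x in Set.Ioi (0 : ℝ), x ^ 2 * exp (-(c ^ 2) * x ^ 2) := by
    rw [← integral_comp_abs (f := fun x => x ^ 2 * exp (-(c ^ 2) * x ^ 2))]
    simp
  simp only [rpow_ofNat] at h
  rw [h1, h]
  have hG : Gamma ((2 + 1) / 2) = √π / 2 := by
    rw [show ((2 : ℝ) + 1) / 2 = 1 / 2 + 1 by norm_num, Gamma_add_one (by norm_num),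
      Gamma_one_half_eq]
    ring
  have hp : (c ^ 2) ^ (-(2 + 1) / 2 : ℝ) = (c ^ 3)⁻¹ := by
    rw [← rpow_natCast c 2, ← rpow_mul hc.le, ← rpow_natCast c 3, ← rpow_neg hc.le]
    norm_num
  rw [hG, hp]
  field_simp

open Real in
theorem integral_pow_four_mul_gaussian {c : ℝ} (hc : 0 < c) :
    ∫ x : ℝ, x ^ 4 * exp (-(c ^ 2) * x ^ 2) = 3 * √π / (4 * c ^ 5) := by
  have h := integral_rpow_mul_exp_neg_mul_rpow (p := 2) (q := 4) (b := c ^ 2)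
    (by norm_num) (by norm_num) (by positivity)
  have h1 : ∫ x : ℝ, x ^ 4 * exp (-(c ^ 2) * x ^ 2)
      = 2 * ∫ x in Set.Ioi (0 : ℝ), x ^ 4 * exp (-(c ^ 2) * x ^ 2) := by
    rw [← integral_comp_abs (f := fun x => x ^ 4 * exp (-(c ^ 2) * x ^ 2))]
    simp [Even.pow_abs (show Even 4 by decide)]
  simp only [rpow_ofNat] at h
  rw [h1, h]
  have hG : Gamma ((4 + 1) / 2) = 3 * √π / 4 := by
    rw [show ((4 : ℝ) + 1) / 2 = 1 / 2 + 1 + 1 by norm_num, Gamma_add_one (by norm_num),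
      Gamma_add_one (by norm_num), Gamma_one_half_eq]
    ring
  have hp : (c ^ 2) ^ (-(4 + 1) / 2 : ℝ) = (c ^ 5)⁻¹ := by
    rw [← rpow_natCast c 2, ← rpow_mul hc.le, ← rpow_natCast c 5, ← rpow_neg hc.le]
    norm_num
  rw [hG, hp]
  field_simp

theorem integrable_pow_mul_gaussian (k : ℕ) {c : ℝ} (hc : 0 < c) :
    Integrable fun x : ℝ => x ^ k * Real.exp (-(c ^ 2) * x ^ 2) := by
  have := integrable_rpow_mul_exp_neg_mul_sq (b := c ^ 2) (by positivity) (s := k)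
    (by linarith [(Nat.cast_nonneg k : (0 : ℝ) ≤ k)])
  simpa using this

open Real in
/-- The Gaussian integral over `[-δ, δ]` misses at most a fraction `exp (-c² δ²)`. -/
theorem gaussian_interval_lower {c δ : ℝ} (hc : 0 < c) (hδ : 0 < δ) :
    √π / c * (1 - exp (-(c ^ 2) * δ ^ 2)) ≤ ∫ x in -δ..δ, exp (-(c ^ 2) * x ^ 2) := by
  have hint : Integrable fun x : ℝ => exp (-(c ^ 2) * x ^ 2) :=
    integrable_exp_neg_mul_sq (by positivity)
  have htot : ∫ x in Set.Ioi (0 : ℝ), exp (-(c ^ 2) * x ^ 2) = √π / c / 2 := by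
    rw [integral_gaussian_Ioi, sqrt_div pi_pos.le, sqrt_sq hc.le]
  have hsplit : ∫ x in (0 : ℝ)..δ, exp (-(c ^ 2) * x ^ 2)
      = √π / c / 2 - ∫ x in Set.Ioi δ, exp (-(c ^ 2) * x ^ 2) := by
    rw [← htot, eq_sub_iff_add_eq]
    exact intervalIntegral.integral_interval_add_Ioi hint.integrableOn hint.integrableOn
  have htail : ∫ x in Set.Ioi δ, exp (-(c ^ 2) * x ^ 2)
      ≤ exp (-(c ^ 2) * δ ^ 2) * (√π / c / 2) := by
    rw [← htot, ← integral_const_mul]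
    have := (measurePreserving_add_right volume δ).setIntegral_preimage_emb
      (measurableEmbedding_addRight δ) (fun x => exp (-(c ^ 2) * x ^ 2)) (Set.Ioi δ)
    rw [Set.preimage_add_const_Ioi, sub_self] at this
    rw [← this]
    refine setIntegral_mono_on (hint.comp_add_right δ).integrableOn
      (hint.const_mul _).integrableOn measurableSet_Ioi fun x hx => ?_
    rw [← exp_add]
    apply exp_le_exp.2
    have : 0 ≤ c ^ 2 * (x * δ) := by
      have : 0 < x := hx
      positivity
    nlinarith
  have hsymm : ∫ x in -δ..(0 : ℝ), exp (-(c ^ 2) * x ^ 2)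
      = ∫ x in (0 : ℝ)..δ, exp (-(c ^ 2) * x ^ 2) := by
    have := intervalIntegral.integral_comp_neg (a := 0) (b := δ)
      (fun x => exp (-(c ^ 2) * x ^ 2))
    simpa using this.symm
  rw [← intervalIntegral.integral_add_adjacent_intervals (b := 0) hint.intervalIntegrable
    hint.intervalIntegrable, hsymm, hsplit]
  linarith

theorem intervalIntegral_le_integral {f : ℝ → ℝ} (hf : Integrable f) (h0 : ∀ x, 0 ≤ f x)
    {a b : ℝ} (hab : a ≤ b) : ∫ x in a..b, f x ≤ ∫ x, f x := by
  rw [intervalIntegral.integral_of_le hab]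
  exact setIntegral_le_integral hf (Filter.Eventually.of_forall h0)

open Real in
theorem one_sub_cos_le (x : ℝ) : 1 - cos x ≤ x ^ 2 / 2 := by
  linarith [one_sub_sq_div_two_le_cos (x := x)]

open Real in
/-- Laplace bound for the integral of `exp (-c² sin² x)`. -/
theorem integral_exp_neg_sin_sq_le {c : ℝ} (hc : 0 < c) :
    ∫ x in (-(π / 2))..(π / 2), exp (-(c ^ 2) * sin x ^ 2)
      ≤ √π / c * (1 + 1 / c ^ 2) := by
  have hpi := pi_pos
  have hab : -(π / 2) ≤ π / 2 := by linarith
  have hcont : Continuous fun x : ℝ => exp (-(c ^ 2) * sin x ^ 2) := by fun_prop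
  -- Writing `1 = cos x + (1 - cos x)`, the first part is an exact Gaussian integral in `u = sin x`.
  -- In the second, `1 - cos x ≤ x²/2` and `|sin x| ≥ 2|x|/π` give a Gaussian second moment with
  -- constant `π³/32 < 1`.
  have h1 : ∫ x in (-(π / 2))..(π / 2), exp (-(c ^ 2) * sin x ^ 2) * cos x ≤ √π / c := by
    have := intervalIntegral.integral_comp_mul_deriv (a := -(π / 2)) (b := π / 2)
      (f := sin) (f' := cos) (g := fun u => exp (-(c ^ 2) * u ^ 2))
      (fun x _ => hasDerivAt_sin x) continuous_cos.continuousOn (by fun_prop)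
    simp only [Function.comp] at this
    rw [this]
    refine (intervalIntegral_le_integral (integrable_exp_neg_mul_sq (by positivity))
      (fun x => (exp_pos _).le) (by simp)).trans ?_
    rw [integral_gaussian, sqrt_div pi_pos.le, sqrt_sq hc.le]
  have h2 : ∫ x in (-(π / 2))..(π / 2), exp (-(c ^ 2) * sin x ^ 2) * (1 - cos x)
      ≤ √π / c * (1 / c ^ 2) := by
    have hk : 0 < c * (2 / π) := by positivity
    have hint := (integrable_pow_mul_gaussian 2 hk).div_const 2
    calc ∫ x in (-(π / 2))..(π / 2), exp (-(c ^ 2) * sin x ^ 2) * (1 - cos x)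
        ≤ ∫ x in (-(π / 2))..(π / 2), x ^ 2 * exp (-((c * (2 / π)) ^ 2) * x ^ 2) / 2 := by
          refine intervalIntegral.integral_mono_on hab
            (Continuous.intervalIntegrable (by fun_prop) _ _) hint.intervalIntegrable ?_
          intro x hx
          have hs : (2 / π * |x|) ^ 2 ≤ |sin x| ^ 2 :=
            pow_le_pow_left₀ (by positivity) (mul_abs_le_abs_sin (abs_le.2 ⟨hx.1, hx.2⟩)) 2
          rw [sq_abs, mul_pow, sq_abs] at hs
          have he : exp (-(c ^ 2) * sin x ^ 2) ≤ exp (-((c * (2 / π)) ^ 2) * x ^ 2) := by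
            apply exp_le_exp.2
            have := mul_le_mul_of_nonneg_left hs (sq_nonneg c)
            nlinarith
          calc _ ≤ exp (-((c * (2 / π)) ^ 2) * x ^ 2) * (x ^ 2 / 2) :=
                mul_le_mul he (one_sub_cos_le x) (by linarith [cos_le_one x]) (exp_pos _).le
            _ = _ := by ring
      _ ≤ ∫ x, x ^ 2 * exp (-((c * (2 / π)) ^ 2) * x ^ 2) / 2 :=
          intervalIntegral_le_integral hint (fun x => by positivity) hab
      _ = √π / c * (π ^ 3 / 32 / c ^ 2) := by
          rw [integral_div, integral_sq_mul_gaussian hk]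
          field_simp
          norm_num
      _ ≤ _ := by
          have h3 : π ^ 3 ≤ 3.15 ^ 3 := pow_le_pow_left₀ hpi.le (by linarith [pi_lt_d2]) 3
          gcongr
          linarith
  have hadd := intervalIntegral.integral_add (μ := volume) (a := -(π / 2)) (b := π / 2)
    (f := fun x => exp (-(c ^ 2) * sin x ^ 2) * cos x)
    (g := fun x => exp (-(c ^ 2) * sin x ^ 2) * (1 - cos x))
    (Continuous.intervalIntegrable (by fun_prop) _ _)
    (Continuous.intervalIntegrable (by fun_prop) _ _)
  have heq : ∫ x in (-(π / 2))..(π / 2), exp (-(c ^ 2) * sin x ^ 2)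
      = ∫ x in (-(π / 2))..(π / 2), (exp (-(c ^ 2) * sin x ^ 2) * cos x
        + exp (-(c ^ 2) * sin x ^ 2) * (1 - cos x)) :=
    intervalIntegral.integral_congr fun x _ => by ring
  rw [heq, hadd, mul_add, mul_one]
  exact add_le_add h1 h2

/-! ### A single spin -/

-- With `u = x²/2 ≤ 1/2`, `cos x ≥ 1 - u ≥ e^{-(u + u²)}`; squaring doubles the exponent.
open Real in
theorem exp_neg_le_cos_sq {x : ℝ} (hx : x ^ 2 ≤ 1) : exp (-(x ^ 2 + x ^ 4 / 2)) ≤ cos x ^ 2 := by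
  set u := x ^ 2 / 2 with hu
  have hu0 : 0 ≤ u := by positivity
  have hu1 : u ≤ 1 / 2 := by linarith
  have h1 : 1 ≤ exp (u + u ^ 2) * (1 - u) := by
    have h := quadratic_le_exp_of_nonneg (x := u + u ^ 2) (by positivity)
    have h2 : 1 ≤ (1 + (u + u ^ 2) + (u + u ^ 2) ^ 2 / 2) * (1 - u) := by
      have : 0 ≤ 1 - u - u ^ 2 - u ^ 3 := by nlinarith [mul_nonneg hu0 hu0]
      nlinarith [mul_nonneg (mul_nonneg hu0 hu0) this]
    exact h2.trans (mul_le_mul_of_nonneg_right h (by linarith))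
  have h3 : exp (-(u + u ^ 2)) ≤ cos x := by
    have h4 : exp (-(u + u ^ 2)) ≤ 1 - u := by
      rw [exp_neg, inv_le_iff_one_le_mul₀ (exp_pos _), mul_comm]
      exact h1
    linarith [one_sub_sq_div_two_le_cos (x := x)]
  have h5 := pow_le_pow_left₀ (exp_pos _).le h3 2
  rw [← exp_nat_mul] at h5
  refine le_trans (le_of_eq ?_) h5
  congr 1
  rw [hu]
  push_cast
  ring

open Real in
/-- The squared modulus of the characteristic function of a spin with mean `μ / 2`. -/
theorem exp_neg_le_modulus_sq {μ x : ℝ} (hμ : μ ^ 2 ≤ 1) (hx : x ^ 2 ≤ 1) :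
    exp (-((1 - μ ^ 2) * (x ^ 2 + x ^ 4 / 2))) ≤ 1 - (1 - μ ^ 2) * sin x ^ 2 := by
  -- The right-hand side is the convex combination `(1 - μ²) cos² x + μ² · 1`, so convexity of `exp`
  -- reduces the claim to `μ = 0`.
  have h := convexOn_exp.2 (Set.mem_univ (-(x ^ 2 + x ^ 4 / 2))) (Set.mem_univ 0)
    (sub_nonneg.2 hμ) (sq_nonneg μ) (by ring)
  simp only [smul_eq_mul, mul_zero, add_zero, exp_zero, mul_one] at h
  have h2 := mul_le_mul_of_nonneg_left (exp_neg_le_cos_sq hx) (sub_nonneg.2 hμ)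
  have h3 := sin_sq_add_cos_sq x
  rw [show -((1 - μ ^ 2) * (x ^ 2 + x ^ 4 / 2)) = (1 - μ ^ 2) * (-(x ^ 2 + x ^ 4 / 2)) by ring]
  have h4 : cos x ^ 2 = 1 - sin x ^ 2 := by linarith
  rw [h4] at h2
  linarith

/-- The phase of the characteristic function of a spin with mean `μ / 2`, centred. -/
def phase (μ x : ℝ) : ℝ := Real.arctan (μ * Real.tan x) - μ * x

theorem phase_neg (μ x : ℝ) : phase μ (-x) = -phase μ x := by
  simp [phase, Real.tan_neg, Real.arctan_neg]; ring

-- The factor `sin² x` makes the centred phase of third order, and `1 - μ²` makes the sum of the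
-- phases proportional to the variance.
open Real in
theorem hasDerivAt_phase (μ : ℝ) {x : ℝ} (hx : cos x ≠ 0) :
    HasDerivAt (phase μ) (μ * (1 - μ ^ 2) * sin x ^ 2 / (1 - (1 - μ ^ 2) * sin x ^ 2)) x := by
  have h1 := (((hasDerivAt_tan hx).const_mul μ).arctan).sub ((hasDerivAt_id x).const_mul μ)
  refine h1.congr_deriv ?_
  have hs : sin x ^ 2 = 1 - cos x ^ 2 := by linarith [sin_sq_add_cos_sq x]
  have hc : 0 < cos x ^ 2 := by positivity
  have hden : 1 - (1 - μ ^ 2) * sin x ^ 2 ≠ 0 := by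
    rw [hs]
    nlinarith [mul_nonneg (sq_nonneg μ) (show 0 ≤ 1 - cos x ^ 2 by nlinarith [sq_nonneg (sin x)])]
  have hden2 : 1 + (μ * tan x) ^ 2 = (1 - (1 - μ ^ 2) * sin x ^ 2) / cos x ^ 2 := by
    rw [tan_eq_sin_div_cos]
    field_simp
    linarith
  rw [hden2]
  field_simp
  rw [hs]
  ring

-- Polar form: since `cos x > 0`, the argument is the arctangent of `μ tan x`, with no branch to
-- choose.
open Real in
theorem cos_add_sin_mul_I_eq {μ x : ℝ} (hx : 0 < cos x) :
    ((cos x : ℂ) + μ * sin x * Complex.I) * Complex.exp (-(μ * x) * Complex.I)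
      = (√(1 - (1 - μ ^ 2) * sin x ^ 2) : ℝ) * Complex.exp (phase μ x * Complex.I) := by
  have hs : sin x ^ 2 = 1 - cos x ^ 2 := by linarith [sin_sq_add_cos_sq x]
  have hden2 : 1 + (μ * tan x) ^ 2 = (1 - (1 - μ ^ 2) * sin x ^ 2) / cos x ^ 2 := by
    rw [tan_eq_sin_div_cos]
    field_simp
    linarith
  have hpos : 0 < 1 - (1 - μ ^ 2) * sin x ^ 2 := by
    have h : 0 < (1 - (1 - μ ^ 2) * sin x ^ 2) / cos x ^ 2 := by rw [← hden2]; positivity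
    exact (div_pos_iff_of_pos_right (by positivity)).1 h
  have hsq : √(1 + (μ * tan x) ^ 2) = √(1 - (1 - μ ^ 2) * sin x ^ 2) / cos x := by
    rw [hden2, sqrt_div hpos.le, sqrt_sq hx.le]
  have hr : 0 < √(1 - (1 - μ ^ 2) * sin x ^ 2) := sqrt_pos.2 hpos
  have h1 : ((cos x : ℂ) + μ * sin x * Complex.I)
      = (√(1 - (1 - μ ^ 2) * sin x ^ 2) : ℝ)
        * Complex.exp ((arctan (μ * tan x) : ℝ) * Complex.I) := by
    rw [Complex.exp_mul_I, ← Complex.ofReal_cos, ← Complex.ofReal_sin, cos_arctan, sin_arctan, hsq,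
      tan_eq_sin_div_cos]
    set r := √(1 - (1 - μ ^ 2) * sin x ^ 2)
    have e1 : r * (1 / (r / cos x)) = cos x := by field_simp
    have e2 : r * (μ * (sin x / cos x) / (r / cos x)) = μ * sin x := by field_simp
    have e3 : (r : ℂ) * (1 / (r / cos x) : ℝ) = cos x := by rw [← Complex.ofReal_mul, e1]
    have e4 : (r : ℂ) * (μ * (sin x / cos x) / (r / cos x) : ℝ) = μ * sin x := by
      rw [← Complex.ofReal_mul, e2, Complex.ofReal_mul]
    rw [mul_add, ← mul_assoc, e3, e4]
  rw [h1, mul_assoc, ← Complex.exp_add]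
  congr 2
  simp only [phase]
  push_cast
  ring

open Real in
theorem abs_phase_le {μ x : ℝ} (hμ : μ ^ 2 ≤ 1) (hx : x ^ 2 ≤ 0.708) :
    |phase μ x| ≤ (1 - μ ^ 2) * |x| ^ 3 / 2 := by
  wlog hx0 : 0 ≤ x generalizing x
  · have := this (x := -x) (by simpa using hx) (by linarith)
    simpa [phase_neg] using this
  rw [abs_of_nonneg hx0]
  have hcos : ∀ y ∈ Set.Icc 0 x, 0.646 ≤ cos y := fun y hy => by
    have := one_sub_sq_div_two_le_cos (x := y)
    have : y ^ 2 ≤ x ^ 2 := pow_le_pow_left₀ hy.1 hy.2 2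
    linarith
  have key : ∀ y ∈ Set.Icc 0 x,
      |μ * (1 - μ ^ 2) * sin y ^ 2 / (1 - (1 - μ ^ 2) * sin y ^ 2)|
        ≤ (1 - μ ^ 2) * (3 * y ^ 2) / 2 := fun y hy => by
    have hc := hcos y hy
    have hs : sin y ^ 2 ≤ 0.6 := by nlinarith [sin_sq_add_cos_sq y]
    have hv : 0 ≤ 1 - μ ^ 2 := by linarith
    -- With `sin² y ≤ 0.6` the right side is at least `0.6 + 0.9 μ²`, and `0.9 μ² - |μ| + 0.6` has
    -- negative discriminant. The factor `3/2` matches the derivative of `y³/2`.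
    have hden : |μ| ≤ 3 / 2 * (1 - (1 - μ ^ 2) * sin y ^ 2) := by
      have h1 := mul_le_mul_of_nonneg_left hs hv
      have h2 : |μ| ^ 2 = μ ^ 2 := sq_abs μ
      nlinarith [sq_nonneg (|μ| - 1 / 2)]
    have hpos : 0 < 1 - (1 - μ ^ 2) * sin y ^ 2 := by
      nlinarith [mul_le_mul_of_nonneg_left hs hv, sq_nonneg μ]
    have hsy : sin y ^ 2 ≤ y ^ 2 := sin_sq_le_sq
    rw [abs_div, abs_of_pos hpos, div_le_iff₀ hpos, abs_mul, abs_mul, abs_of_nonneg hv,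
      abs_of_nonneg (sq_nonneg (sin y))]
    have h3 := mul_le_mul hden hsy (sq_nonneg _) (by linarith)
    nlinarith [mul_le_mul_of_nonneg_left h3 hv]
  have hcubic : ∀ y : ℝ, HasDerivAt (fun y => (1 - μ ^ 2) * y ^ 3 / 2)
      ((1 - μ ^ 2) * (3 * y ^ 2) / 2) y := fun y => by
    have := ((hasDerivAt_pow 3 y).const_mul (1 - μ ^ 2)).div_const 2
    simpa using this
  have hmono : ∀ s : ℝ, |s| = 1 → s * phase μ x ≤ (1 - μ ^ 2) * x ^ 3 / 2 := fun s hs => by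
    have hd : ∀ y ∈ Set.Icc 0 x, HasDerivAt (fun y => (1 - μ ^ 2) * y ^ 3 / 2 - s * phase μ y)
        ((1 - μ ^ 2) * (3 * y ^ 2) / 2
          - s * (μ * (1 - μ ^ 2) * sin y ^ 2 / (1 - (1 - μ ^ 2) * sin y ^ 2))) y := fun y hy =>
      (hcubic y).sub ((hasDerivAt_phase μ (by linarith [hcos y hy])).const_mul s)
    have hm : MonotoneOn (fun y => (1 - μ ^ 2) * y ^ 3 / 2 - s * phase μ y) (Set.Icc 0 x) := by
      refine monotoneOn_of_hasDerivWithinAt_nonneg (convex_Icc 0 x)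
        (fun y hy => (hd y hy).continuousAt.continuousWithinAt)
        (fun y hy => (hd y (interior_subset hy)).hasDerivWithinAt) fun y hy => ?_
      have h1 := key y (interior_subset hy)
      have h2 := le_abs_self
        (s * (μ * (1 - μ ^ 2) * sin y ^ 2 / (1 - (1 - μ ^ 2) * sin y ^ 2)))
      rw [abs_mul, hs, one_mul] at h2
      linarith
    have := hm (Set.left_mem_Icc.2 hx0) (Set.right_mem_Icc.2 hx0) hx0
    simp [phase] at this
    simp only [phase]
    linarith
  rw [abs_le]
  have h1 := hmono 1 (by simp)
  have h2 := hmono (-1) (by simp)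
  constructor <;> linarith

/-! ### Sums of independent spins -/

section SpinLaw

variable {ι : Type*} [Fintype ι]

/-- The probability of a configuration of independent spins with means `μ i / 2`. -/
def productWeight (μ : ι → ℝ) (σ : ι → Bool) : ℝ := ∏ i, (1 + 2 * spin (σ i) * μ i) / 2

open Classical in
/-- The probability that independent spins with means `μ i / 2` add up to `M`. -/
def spinLaw [DecidableEq ι] (μ : ι → ℝ) (M : ℝ) : ℝ :=
  ∑ σ : ι → Bool, if ∑ i, spin (σ i) = M then productWeight μ σ else 0

/-- The variance of a sum of independent spins with means `μ i / 2`. -/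
def spinVariance (μ : ι → ℝ) : ℝ := 1 / 4 * ∑ i, (1 - μ i ^ 2)

/-- The characteristic function of a spin with mean `μ / 2`, at `2 x`. -/
def spinChar (μ x : ℝ) : ℂ := (Real.cos x : ℂ) + μ * Real.sin x * Complex.I

theorem spin_true : spin true = 1 / 2 := rfl

theorem spin_false : spin false = -(1 / 2) := rfl

/-- Independence turns the characteristic function into a product. It is taken at `2x`, so that each
factor is `cos x + iμ sin x`. -/
theorem sum_productWeight_mul_exp [DecidableEq ι] (μ : ι → ℝ) (x : ℝ) :
    ∑ σ : ι → Bool, (productWeight μ σ : ℂ) * Complex.exp (2 * (∑ i, spin (σ i) : ℝ) * x * Complex.I)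
      = ∏ i, spinChar (μ i) x := by
  have h : ∀ i, spinChar (μ i) x = ∑ b : Bool, (((1 + 2 * spin b * μ i) / 2 : ℝ) : ℂ)
      * Complex.exp (2 * (spin b : ℝ) * x * Complex.I) := fun i => by
    simp only [Fintype.sum_bool, spin_true, spin_false]
    push_cast
    rw [show (2 * (1 / 2) * (x : ℂ) * Complex.I) = x * Complex.I by ring,
      show (2 * -(1 / 2) * (x : ℂ) * Complex.I) = (-x : ℂ) * Complex.I by ring,
      Complex.exp_mul_I, Complex.exp_mul_I, Complex.cos_neg, Complex.sin_neg, spinChar]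
    push_cast
    ring
  simp only [h]
  rw [Finset.prod_univ_sum, Fintype.piFinset_univ]
  refine Finset.sum_congr rfl fun σ _ => ?_
  rw [Finset.prod_mul_distrib, ← Complex.exp_sum, productWeight]
  push_cast
  congr 2
  rw [Finset.mul_sum, Finset.sum_mul, Finset.sum_mul]

theorem integral_exp_int_mul (k : ℤ) :
    ∫ x in (-(Real.pi / 2))..(Real.pi / 2), Complex.exp (2 * k * x * Complex.I)
      = if k = 0 then (Real.pi : ℂ) else 0 := by
  split_ifs with hk
  · subst hk
    simp
  · have hc : (2 * k * Complex.I : ℂ) ≠ 0 := by simp [hk]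
    have := integral_exp_mul_complex (a := -(Real.pi / 2)) (b := Real.pi / 2) hc
    rw [show (fun x : ℝ => Complex.exp (2 * k * x * Complex.I))
      = fun x : ℝ => Complex.exp (2 * k * Complex.I * x) from by ext x; ring_nf, this]
    have h : Complex.exp (2 * k * Complex.I * (Real.pi / 2 : ℝ))
        = Complex.exp (2 * k * Complex.I * (-(Real.pi / 2) : ℝ)) := by
      rw [Complex.exp_eq_exp_iff_exists_int]
      exact ⟨k, by push_cast; ring⟩
    rw [h, sub_self, zero_div]

theorem exists_int_sum_spin_sub (σ τ : ι → Bool) :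
    ∃ k : ℤ, ∑ i, spin (σ i) - ∑ i, spin (τ i) = k := by
  refine ⟨∑ i, ((if σ i then 1 else 0) - (if τ i then 1 else 0)), ?_⟩
  rw [← Finset.sum_sub_distrib]
  push_cast
  refine Finset.sum_congr rfl fun i _ => ?_
  cases σ i <;> cases τ i <;> norm_num [spin]

theorem continuous_spinChar (μ : ℝ) : Continuous (spinChar μ) := by
  unfold spinChar
  fun_prop

/-- Fourier inversion over one period of length `π`. Attainability of `M` makes every difference of
a total spin and `M` an integer, as orthogonality requires. -/
theorem pi_mul_spinLaw [DecidableEq ι] (μ : ι → ℝ) {M : ℝ} (hM : ∃ τ : ι → Bool, ∑ i, spin (τ i) = M) :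
    ((Real.pi * spinLaw μ M : ℝ) : ℂ)
      = ∫ x in (-(Real.pi / 2))..(Real.pi / 2),
        (∏ i, spinChar (μ i) x) * Complex.exp (-(2 * M * x) * Complex.I) := by
  obtain ⟨τ, rfl⟩ := hM
  simp only [← sum_productWeight_mul_exp, Finset.sum_mul]
  rw [intervalIntegral.integral_finsetSum
    fun σ _ => Continuous.intervalIntegrable (by fun_prop) _ _]
  rw [spinLaw, Finset.mul_sum]
  push_cast
  refine Finset.sum_congr rfl fun σ _ => ?_
  obtain ⟨k, hk⟩ := exists_int_sum_spin_sub σ τ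
  have h : ∀ x : ℝ, (productWeight μ σ : ℂ)
      * Complex.exp (2 * (∑ i, spin (σ i) : ℝ) * x * Complex.I)
      * Complex.exp (-(2 * (∑ i, spin (τ i) : ℝ) * x) * Complex.I)
      = productWeight μ σ * Complex.exp (2 * k * x * Complex.I) := fun x => by
    rw [mul_assoc, ← Complex.exp_add]
    congr 2
    have hk' : (k : ℂ) = ((∑ i, spin (σ i) : ℝ) : ℂ) - ((∑ i, spin (τ i) : ℝ) : ℂ) := by
      rw [← Complex.ofReal_sub, hk]; simp
    rw [hk']
    ring
  have h2 := intervalIntegral.integral_congr (μ := volume) (a := -(Real.pi / 2))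
    (b := Real.pi / 2) fun x _ => h x
  push_cast at h2 ⊢
  rw [h2, intervalIntegral.integral_const_mul, integral_exp_int_mul]
  have h3 : (∑ i, spin (σ i) = ∑ i, spin (τ i)) ↔ k = 0 := by
    rw [← sub_eq_zero, hk]; simp
  simp only [h3]
  split_ifs <;> simp [mul_comm]

theorem norm_spinChar_sq (μ x : ℝ) :
    ‖spinChar μ x‖ ^ 2 = 1 - (1 - μ ^ 2) * Real.sin x ^ 2 := by
  have : spinChar μ x = (Real.cos x : ℝ) + ((μ * Real.sin x : ℝ) : ℂ) * Complex.I := by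
    simp [spinChar]
  rw [this, Complex.sq_norm, Complex.normSq_add_mul_I]
  linear_combination Real.sin_sq_add_cos_sq x

/-- Apply `1 - a ≤ e^{-a}` to each squared modulus; the numbers `1 - μ i ^ 2` add up to four times
the variance. -/
theorem norm_prod_spinChar_le (μ : ι → ℝ) (x : ℝ) :
    ‖∏ i, spinChar (μ i) x‖ ≤ Real.exp (-(2 * spinVariance μ) * Real.sin x ^ 2) := by
  refine le_of_sq_le_sq ?_ (Real.exp_pos _).le
  rw [norm_prod, ← Finset.prod_pow, ← Real.exp_nat_mul]
  calc ∏ i, ‖spinChar (μ i) x‖ ^ 2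
      ≤ ∏ i, Real.exp (-((1 - μ i ^ 2) * Real.sin x ^ 2)) := by
        refine Finset.prod_le_prod (fun i _ => by positivity) fun i _ => ?_
        rw [norm_spinChar_sq]
        linarith [Real.add_one_le_exp (-((1 - μ i ^ 2) * Real.sin x ^ 2))]
    _ = _ := by
        rw [← Real.exp_sum, Finset.sum_neg_distrib, ← Finset.sum_mul, spinVariance]
        congr 1
        push_cast
        ring

theorem productWeight_nonneg {μ : ι → ℝ} (hμ : ∀ i, μ i ^ 2 ≤ 1) (σ : ι → Bool) :
    0 ≤ productWeight μ σ := by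
  refine Finset.prod_nonneg fun i _ => ?_
  have := abs_le.1 (abs_le_one_iff_mul_self_le_one.2 (by simpa [sq] using hμ i))
  cases σ i
  · rw [spin_false]; linarith
  · rw [spin_true]; linarith

theorem norm_exp_neg_mul_I (y : ℝ) : ‖Complex.exp (-y * Complex.I)‖ = 1 := by
  have := Complex.norm_exp_ofReal_mul_I (-y)
  simpa using this

open Real in
/-- No value of the total spin is more likely than `1 / √(2 π V)`, up to a relative error
`1 / (2 V)`, where `V` is the variance. -/
theorem spinLaw_upper [DecidableEq ι] (μ : ι → ℝ) (hV : 0 < spinVariance μ) (M : ℝ) :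
    spinLaw μ M * √(2 * π * spinVariance μ) ≤ 1 + 1 / (2 * spinVariance μ) := by
  set V := spinVariance μ with hVdef
  by_cases hM : ∃ τ : ι → Bool, ∑ i, spin (τ i) = M
  · have hpi := pi_pos
    set c := √(2 * V) with hc
    have hc0 : 0 < c := sqrt_pos.2 (by linarith)
    have hc2 : c ^ 2 = 2 * V := sq_sqrt (by linarith)
    have hsq : √(2 * π * V) = √π * c := by
      rw [hc, ← sqrt_mul hpi.le]; ring_nf
    have h1 : π * spinLaw μ M ≤ √π / c * (1 + 1 / c ^ 2) := by
      refine le_trans ?_ (integral_exp_neg_sin_sq_le hc0)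
      calc π * spinLaw μ M ≤ ‖((π * spinLaw μ M : ℝ) : ℂ)‖ := by
            rw [Complex.norm_real]; exact le_abs_self _
        _ ≤ _ := by
            rw [pi_mul_spinLaw μ hM]
            refine intervalIntegral.norm_integral_le_of_norm_le (by linarith)
              (Filter.Eventually.of_forall fun x _ => ?_)
              (Continuous.intervalIntegrable (by fun_prop) _ _)
            rw [norm_mul, hc2]
            have := norm_exp_neg_mul_I (2 * M * x)
            push_cast at this
            rw [this, mul_one]
            exact norm_prod_spinChar_le μ x
    rw [hsq, ← hc2]
    have h2 := mul_le_mul_of_nonneg_right h1 (show 0 ≤ √π * c / π by positivity)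
    have h3 : √π * √π = π := mul_self_sqrt hpi.le
    calc spinLaw μ M * (√π * c) = π * spinLaw μ M * (√π * c / π) := by field_simp
      _ ≤ _ := h2
      _ = (√π * √π) / π * (1 + 1 / c ^ 2) := by field_simp
      _ = _ := by rw [h3, div_self hpi.ne', one_mul]
  · have : spinLaw μ M = 0 :=
      Finset.sum_eq_zero fun σ _ => if_neg fun h => hM ⟨σ, h⟩
    rw [this, zero_mul]
    positivity

/-! ### Lower bound for the probability of the mean value. -/

theorem sq_mul_le_sin_sq {x δ : ℝ} (hδ : δ ^ 2 ≤ 6) (hx : |x| ≤ δ) :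
    (1 - δ ^ 2 / 6) ^ 2 * x ^ 2 ≤ Real.sin x ^ 2 := by
  wlog hx0 : 0 ≤ x generalizing x
  · have := this (x := -x) (by simpa using hx) (by linarith)
    simpa using this
  rw [abs_of_nonneg hx0] at hx
  rw [← mul_pow]
  refine pow_le_pow_left₀ (mul_nonneg (by linarith) hx0) ?_ 2
  have h := Real.sin_ge_sub_cube hx0
  have h2 : x ^ 2 ≤ δ ^ 2 := pow_le_pow_left₀ hx0 hx 2
  nlinarith [mul_le_mul_of_nonneg_left h2 hx0]

open Real in
theorem sq_mul_le_sin_sq_of_le {x δ : ℝ} (hδ0 : 0 ≤ δ) (hδ : δ ^ 2 ≤ 6) (hx : δ ≤ |x|)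
    (hx2 : |x| ≤ π / 2) : δ ^ 2 * (1 - δ ^ 2 / 6) ^ 2 ≤ sin x ^ 2 := by
  have h1 : (1 - δ ^ 2 / 6) * δ ≤ sin δ := by
    have := sin_ge_sub_cube hδ0
    nlinarith
  have h2 : sin δ ≤ sin |x| := sin_le_sin_of_le_of_le_pi_div_two (by linarith [pi_pos]) hx2 hx
  have h3 := pow_le_pow_left₀ (mul_nonneg (by linarith) hδ0) (h1.trans h2) 2
  have h4 : sin |x| ^ 2 = sin x ^ 2 := by
    rcases abs_choice x with h | h <;> rw [h]
    simp
  rw [← h4]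
  linarith [h3]

/-- The characteristic function at `2 x` of the centred total spin. -/
def centredChar (μ : ι → ℝ) (x : ℝ) : ℂ :=
  (∏ i, spinChar (μ i) x) * Complex.exp (-(2 * (1 / 2 * ∑ i, μ i : ℝ) * x) * Complex.I)

theorem continuous_centredChar (μ : ι → ℝ) : Continuous (centredChar μ) := by
  unfold centredChar
  have := fun i => continuous_spinChar (μ i)
  fun_prop

theorem norm_centredChar (μ : ι → ℝ) (x : ℝ) :
    ‖centredChar μ x‖ = ∏ i, ‖spinChar (μ i) x‖ := by
  have := norm_exp_neg_mul_I (2 * (1 / 2 * ∑ i, μ i : ℝ) * x)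
  rw [centredChar, norm_mul, norm_prod]
  push_cast at this ⊢
  rw [this, mul_one]

theorem norm_centredChar_le (μ : ι → ℝ) (x : ℝ) :
    ‖centredChar μ x‖ ≤ Real.exp (-(2 * spinVariance μ) * Real.sin x ^ 2) := by
  rw [norm_centredChar, ← norm_prod]
  exact norm_prod_spinChar_le μ x

theorem centredChar_eq (μ : ι → ℝ) {x : ℝ} (hx : 0 < Real.cos x) :
    centredChar μ x = (‖centredChar μ x‖ : ℝ)
      * Complex.exp ((∑ i, phase (μ i) x : ℝ) * Complex.I) := by
  have h : ∀ i, spinChar (μ i) x * Complex.exp (-(μ i * x) * Complex.I)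
      = (‖spinChar (μ i) x‖ : ℝ) * Complex.exp (phase (μ i) x * Complex.I) := fun i => by
    rw [spinChar, cos_add_sin_mul_I_eq hx, ← norm_spinChar_sq, Real.sqrt_sq (norm_nonneg _)]
    rfl
  rw [norm_centredChar]
  push_cast
  rw [Finset.sum_mul, Complex.exp_sum, ← Finset.prod_mul_distrib]
  simp only [← h]
  rw [Finset.prod_mul_distrib, ← Complex.exp_sum, centredChar]
  congr 2
  push_cast
  rw [← Finset.sum_mul, Finset.sum_neg_distrib, ← Finset.sum_mul]
  ring

theorem le_norm_centredChar {μ : ι → ℝ} (hμ : ∀ i, μ i ^ 2 ≤ 1) {x : ℝ} (hx : x ^ 2 ≤ 1) :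
    Real.exp (-(2 * spinVariance μ) * (x ^ 2 + x ^ 4 / 2)) ≤ ‖centredChar μ x‖ := by
  refine le_of_sq_le_sq ?_ (norm_nonneg _)
  rw [norm_centredChar, ← Finset.prod_pow, ← Real.exp_nat_mul]
  calc _ = ∏ i, Real.exp (-((1 - μ i ^ 2) * (x ^ 2 + x ^ 4 / 2))) := by
        rw [← Real.exp_sum, Finset.sum_neg_distrib, ← Finset.sum_mul, spinVariance]
        congr 1
        push_cast
        ring
    _ ≤ _ := Finset.prod_le_prod (fun i _ => (Real.exp_pos _).le) fun i _ => by
        rw [norm_spinChar_sq]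
        exact exp_neg_le_modulus_sq (hμ i) hx

theorem abs_sum_phase_le {μ : ι → ℝ} (hμ : ∀ i, μ i ^ 2 ≤ 1) {x : ℝ} (hx : x ^ 2 ≤ 0.708) :
    |∑ i, phase (μ i) x| ≤ 2 * spinVariance μ * |x| ^ 3 := by
  calc _ ≤ ∑ i, |phase (μ i) x| := Finset.abs_sum_le_sum_abs _ _
    _ ≤ ∑ i, (1 - μ i ^ 2) * |x| ^ 3 / 2 := Finset.sum_le_sum fun i _ => abs_phase_le (hμ i) hx
    _ = _ := by
        rw [← Finset.sum_div, ← Finset.sum_mul, spinVariance]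
        ring

-- The real part is the modulus times the cosine of the total phase `θ`. Here `cos θ ≥ 1 - θ²/2` and
-- `θ² ≤ 4V²|x|⁶ ≤ 4V²δ²x⁴`. The lower bound on the modulus serves the main term, the upper bound
-- the correction.
open Real in
theorem centredChar_re_lower_inner {μ : ι → ℝ} (hμ : ∀ i, μ i ^ 2 ≤ 1) (hV : 0 ≤ spinVariance μ)
    {δ x : ℝ} (hδ : δ ^ 2 ≤ 0.708) (hx : |x| ≤ δ) :
    exp (-(2 * spinVariance μ * (1 + δ ^ 2 / 2)) * x ^ 2)
      - 2 * spinVariance μ ^ 2 * δ ^ 2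
        * (x ^ 4 * exp (-(2 * spinVariance μ * (1 - δ ^ 2 / 6) ^ 2) * x ^ 2))
      ≤ (centredChar μ x).re := by
  set V := spinVariance μ
  have hx2 : x ^ 2 ≤ δ ^ 2 := by
    rw [← sq_abs x]
    exact pow_le_pow_left₀ (abs_nonneg x) hx 2
  have hcos : 0 < cos x := by
    have := one_sub_sq_div_two_le_cos (x := x)
    linarith
  have hre : (centredChar μ x).re = ‖centredChar μ x‖ * cos (∑ i, phase (μ i) x) := by
    conv_lhs => rw [centredChar_eq μ hcos]
    rw [Complex.re_ofReal_mul, Complex.exp_ofReal_mul_I_re]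
  have hph := abs_sum_phase_le hμ (hx2.trans hδ)
  have hph2 : (∑ i, phase (μ i) x) ^ 2 ≤ 4 * V ^ 2 * δ ^ 2 * x ^ 4 := by
    have h := pow_le_pow_left₀ (abs_nonneg _) hph 2
    rw [sq_abs, mul_pow, mul_pow, ← pow_mul, mul_comm 3 2, pow_mul, sq_abs] at h
    have h2 := mul_le_mul_of_nonneg_left hx2 (show 0 ≤ 4 * V ^ 2 * x ^ 4 by positivity)
    nlinarith
  have hcosp := one_sub_sq_div_two_le_cos (x := ∑ i, phase (μ i) x)
  have hup : ‖centredChar μ x‖ ≤ exp (-(2 * V * (1 - δ ^ 2 / 6) ^ 2) * x ^ 2) := by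
    refine (norm_centredChar_le μ x).trans (exp_le_exp.2 ?_)
    have := mul_le_mul_of_nonneg_left (sq_mul_le_sin_sq (by linarith) hx)
      (show 0 ≤ 2 * V by linarith)
    linarith
  have hlo : exp (-(2 * V * (1 + δ ^ 2 / 2)) * x ^ 2) ≤ ‖centredChar μ x‖ := by
    refine (exp_le_exp.2 ?_).trans (le_norm_centredChar hμ (by linarith))
    have := mul_le_mul_of_nonneg_left (mul_le_mul_of_nonneg_left hx2 (sq_nonneg x)) hV
    change _ ≤ -(2 * V) * (x ^ 2 + x ^ 4 / 2)
    nlinarith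
  rw [hre]
  calc _ ≤ ‖centredChar μ x‖ - 2 * V ^ 2 * δ ^ 2 * (x ^ 4 * ‖centredChar μ x‖) := by gcongr
    _ = ‖centredChar μ x‖ * (1 - 4 * V ^ 2 * δ ^ 2 * x ^ 4 / 2) := by ring
    _ ≤ _ := by
        refine mul_le_mul_of_nonneg_left ?_ (norm_nonneg _)
        linarith

open Real in
theorem centredChar_re_lower_outer (μ : ι → ℝ) (hV : 0 ≤ spinVariance μ)
    {δ x : ℝ} (hδ0 : 0 ≤ δ) (hδ : δ ^ 2 ≤ 6) (hx : δ ≤ |x|) (hx2 : |x| ≤ π / 2) :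
    -exp (-(2 * spinVariance μ) * (δ ^ 2 * (1 - δ ^ 2 / 6) ^ 2)) ≤ (centredChar μ x).re := by
  have h1 := (abs_le.1 ((Complex.abs_re_le_norm _).trans (norm_centredChar_le μ x))).1
  refine le_trans (neg_le_neg (exp_le_exp.2 ?_)) h1
  have := mul_le_mul_of_nonneg_left (sq_mul_le_sin_sq_of_le hδ0 hδ hx hx2)
    (show 0 ≤ 2 * spinVariance μ by linarith)
  linarith

-- Cut at `±δ`. Inside stand a truncated Gaussian and a Gaussian fourth moment, the latter extended
-- to the whole line; outside, the integrand is bounded below by minus its modulus bound.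
open Real in
theorem integral_centredChar_re_lower {μ : ι → ℝ} (hμ : ∀ i, μ i ^ 2 ≤ 1)
    (hV : 0 < spinVariance μ) {δ : ℝ} (hδ0 : 0 < δ) (hδ : δ ^ 2 ≤ 0.708) :
    √π / √(2 * spinVariance μ * (1 + δ ^ 2 / 2))
        * (1 - exp (-(2 * spinVariance μ * (1 + δ ^ 2 / 2)) * δ ^ 2))
      - 2 * spinVariance μ ^ 2 * δ ^ 2
        * (3 * √π / (4 * (√(2 * spinVariance μ) * (1 - δ ^ 2 / 6)) ^ 5))
      - π * exp (-(2 * spinVariance μ) * (δ ^ 2 * (1 - δ ^ 2 / 6) ^ 2))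
      ≤ ∫ x in (-(π / 2))..(π / 2), (centredChar μ x).re := by
  set V := spinVariance μ
  set w := exp (-(2 * V) * (δ ^ 2 * (1 - δ ^ 2 / 6) ^ 2)) with hw
  have hδ1 : δ < 1 := by nlinarith
  have hpi : δ < π / 2 := by linarith [pi_gt_three]
  have hcont : Continuous fun x => (centredChar μ x).re :=
    Complex.continuous_re.comp (continuous_centredChar μ)
  have hi : ∀ a b, IntervalIntegrable (fun x => (centredChar μ x).re) volume a b :=
    fun a b => hcont.intervalIntegrable a b
  have hleft : -((π / 2 - δ) * w) ≤ ∫ x in (-(π / 2))..(-δ), (centredChar μ x).re := by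
    have := intervalIntegral.integral_mono_on (μ := volume) (a := -(π / 2)) (b := -δ)
      (f := fun _ => -w) (by linarith) (by simp) (hi _ _) fun x hx =>
        centredChar_re_lower_outer μ hV.le hδ0.le (by linarith)
          (by rw [abs_of_nonpos (by linarith [hx.2])]; linarith [hx.2])
          (by rw [abs_of_nonpos (by linarith [hx.2])]; linarith [hx.1])
    rw [intervalIntegral.integral_const, smul_eq_mul] at this
    linarith
  have hright : -((π / 2 - δ) * w) ≤ ∫ x in δ..(π / 2), (centredChar μ x).re := by
    have := intervalIntegral.integral_mono_on (μ := volume) (a := δ) (b := π / 2)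
      (f := fun _ => -w) (by linarith) (by simp) (hi _ _) fun x hx =>
        centredChar_re_lower_outer μ hV.le hδ0.le (by linarith)
          (by rw [abs_of_nonneg (by linarith [hx.1])]; linarith [hx.1])
          (by rw [abs_of_nonneg (by linarith [hx.1])]; linarith [hx.2])
    rw [intervalIntegral.integral_const, smul_eq_mul] at this
    linarith
  have hc1 : 0 < √(2 * V * (1 + δ ^ 2 / 2)) := by positivity
  have hc2 : 0 < √(2 * V) * (1 - δ ^ 2 / 6) :=
    mul_pos (by positivity) (by linarith)
  have hc1s : √(2 * V * (1 + δ ^ 2 / 2)) ^ 2 = 2 * V * (1 + δ ^ 2 / 2) := sq_sqrt (by positivity)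
  have hc2s : (√(2 * V) * (1 - δ ^ 2 / 6)) ^ 2 = 2 * V * (1 - δ ^ 2 / 6) ^ 2 := by
    rw [mul_pow, sq_sqrt (by positivity)]
  have hmid : √π / √(2 * V * (1 + δ ^ 2 / 2)) * (1 - exp (-(2 * V * (1 + δ ^ 2 / 2)) * δ ^ 2))
      - 2 * V ^ 2 * δ ^ 2 * (3 * √π / (4 * (√(2 * V) * (1 - δ ^ 2 / 6)) ^ 5))
      ≤ ∫ x in (-δ)..δ, (centredChar μ x).re := by
    have hg := gaussian_interval_lower hc1 hδ0
    have hm := intervalIntegral_le_integral (integrable_pow_mul_gaussian 4 hc2)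
      (fun x => mul_nonneg (Even.pow_nonneg (by decide) x) (exp_pos _).le)
      (show -δ ≤ δ by linarith)
    rw [integral_pow_four_mul_gaussian hc2] at hm
    rw [hc1s] at hg
    rw [hc2s] at hm
    calc _ ≤ (∫ x in -δ..δ, exp (-(2 * V * (1 + δ ^ 2 / 2)) * x ^ 2))
          - 2 * V ^ 2 * δ ^ 2
            * ∫ x in -δ..δ, x ^ 4 * exp (-(2 * V * (1 - δ ^ 2 / 6) ^ 2) * x ^ 2) :=
          sub_le_sub hg (mul_le_mul_of_nonneg_left hm (by positivity))
      _ = ∫ x in -δ..δ, (exp (-(2 * V * (1 + δ ^ 2 / 2)) * x ^ 2)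
          - 2 * V ^ 2 * δ ^ 2 * (x ^ 4 * exp (-(2 * V * (1 - δ ^ 2 / 6) ^ 2) * x ^ 2))) := by
          rw [← intervalIntegral.integral_const_mul, intervalIntegral.integral_sub]
          · exact Continuous.intervalIntegrable (by fun_prop) _ _
          · exact Continuous.intervalIntegrable (by fun_prop) _ _
      _ ≤ _ := intervalIntegral.integral_mono_on (by linarith)
          (Continuous.intervalIntegrable (by fun_prop) _ _) (hi _ _) fun x hx =>
            centredChar_re_lower_inner hμ hV.le hδ (abs_le.2 ⟨hx.1, hx.2⟩)
  rw [← intervalIntegral.integral_add_adjacent_intervals (hi (-(π / 2)) (-δ)) (hi (-δ) (π / 2)),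
    ← intervalIntegral.integral_add_adjacent_intervals (hi (-δ) δ) (hi δ (π / 2))]
  have hw0 : 0 < w := exp_pos _
  nlinarith [mul_pos hδ0 hw0]

open Real in
/-- A quantitative local central limit theorem for the most likely value of the total spin. -/
theorem spinLaw_lower [DecidableEq ι] {μ : ι → ℝ} (hμ : ∀ i, μ i ^ 2 ≤ 1) (hV : 0 < spinVariance μ)
    (hM : ∃ τ : ι → Bool, ∑ i, spin (τ i) = 1 / 2 * ∑ i, μ i)
    {δ : ℝ} (hδ0 : 0 < δ) (hδ : δ ^ 2 ≤ 0.708) :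
    1 - δ ^ 2 - (1 + √(2 * π * spinVariance μ))
        * exp (-(2 * spinVariance μ) * (δ ^ 2 * (1 - δ ^ 2 / 6) ^ 2))
      ≤ spinLaw μ (1 / 2 * ∑ i, μ i) * √(2 * π * spinVariance μ) := by
  have hint : π * spinLaw μ (1 / 2 * ∑ i, μ i)
      = ∫ x in (-(π / 2))..(π / 2), (centredChar μ x).re := by
    have h := pi_mul_spinLaw μ hM
    have h2 := congrArg Complex.re h
    rw [Complex.ofReal_re] at h2
    rw [h2]
    exact (intervalIntegral.intervalIntegral_re
      ((continuous_centredChar μ).intervalIntegrable _ _)).symm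
  have hlow := integral_centredChar_re_lower hμ hV hδ0 hδ
  rw [← hint] at hlow
  set V := spinVariance μ
  set P := spinLaw μ (1 / 2 * ∑ i, μ i)
  set w := exp (-(2 * V) * (δ ^ 2 * (1 - δ ^ 2 / 6) ^ 2)) with hw
  set β := 1 - δ ^ 2 / 6 with hβ
  have hpi := pi_pos
  have hd : 0 < δ ^ 2 := by positivity
  set c := √(2 * V) with hc
  have hc0 : 0 < c := sqrt_pos.2 (by linarith)
  have hc2 : c ^ 2 = 2 * V := sq_sqrt (by linarith)
  have hsq : √(2 * π * V) = √π * c := by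
    rw [hc, ← sqrt_mul hpi.le]; ring_nf
  have hsp : √π * √π = π := mul_self_sqrt hpi.le
  have hsp0 : 0 < √π := sqrt_pos.2 hpi
  have hβ1 : 0.882 ≤ β := by linarith
  have hw0 : 0 < w := exp_pos _
  -- The error `δ²` is shared out: `δ²/4` for the quartic term of the modulus and `0.71 δ²` for the
  -- phase. The latter constant bounds `(3/8) / β⁵` with `β ≥ 1 - 0.708/6 = 0.882`.
  have hmain : 1 - δ ^ 2 / 4 - w
      ≤ c / √(2 * V * (1 + δ ^ 2 / 2)) * (1 - exp (-(2 * V * (1 + δ ^ 2 / 2)) * δ ^ 2)) := by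
    have h1 : 1 - δ ^ 2 / 4 ≤ c / √(2 * V * (1 + δ ^ 2 / 2)) := by
      rw [sqrt_mul (by linarith), ← hc, div_mul_cancel_left₀ hc0.ne']
      have h2 : √(1 + δ ^ 2 / 2) ≤ 1 + δ ^ 2 / 4 := by
        rw [sqrt_le_left (by positivity)]
        nlinarith
      have h3 : 0 < √(1 + δ ^ 2 / 2) := by positivity
      rw [le_inv_comm₀ (by linarith) h3]
      refine h2.trans ?_
      rw [le_inv_comm₀ (by positivity) (by linarith), le_inv_comm₀ (by linarith) (by positivity),
        ← one_div, le_div_iff₀ (by linarith)]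
      nlinarith
    have h4 : exp (-(2 * V * (1 + δ ^ 2 / 2)) * δ ^ 2) ≤ w := by
      refine exp_le_exp.2 ?_
      have hb : β ^ 2 ≤ 1 := by nlinarith
      have := mul_le_mul_of_nonneg_left (mul_le_mul_of_nonneg_left hb hd.le) hV.le
      nlinarith [mul_pos hV (mul_pos hd hd)]
    have h5 : exp (-(2 * V * (1 + δ ^ 2 / 2)) * δ ^ 2) ≤ 1 := by
      rw [exp_le_one_iff]
      have := mul_pos hV hd
      nlinarith [mul_pos hV (mul_pos hd hd)]
    have h6 := mul_le_mul_of_nonneg_right h1 (sub_nonneg.2 h5)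
    nlinarith [mul_nonneg hd.le (exp_pos (-(2 * V * (1 + δ ^ 2 / 2)) * δ ^ 2)).le]
  have hphase : c * (2 * V ^ 2 * δ ^ 2 * (3 / (4 * (c * β) ^ 5))) ≤ 0.71 * δ ^ 2 := by
    have hV2 : V = c ^ 2 / 2 := by linarith
    have h1 : c * (2 * V ^ 2 * δ ^ 2 * (3 / (4 * (c * β) ^ 5))) = 3 / 8 / β ^ 5 * δ ^ 2 := by
      rw [hV2]
      field_simp
      norm_num
    rw [h1]
    refine mul_le_mul_of_nonneg_right ?_ hd.le
    have := pow_le_pow_left₀ (by norm_num) hβ1 5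
    rw [div_le_iff₀ (by positivity)]
    norm_num at this ⊢
    linarith
  have hscaled := mul_le_mul_of_nonneg_right hlow (show 0 ≤ √π * c / π by positivity)
  have e1 : π * P * (√π * c / π) = P * (√π * c) := by field_simp
  have e2 : (√π / √(2 * V * (1 + δ ^ 2 / 2)) * (1 - exp (-(2 * V * (1 + δ ^ 2 / 2)) * δ ^ 2))
      - 2 * V ^ 2 * δ ^ 2 * (3 * √π / (4 * (c * β) ^ 5)) - π * w) * (√π * c / π)
      = (√π * √π / π) * (c / √(2 * V * (1 + δ ^ 2 / 2))
          * (1 - exp (-(2 * V * (1 + δ ^ 2 / 2)) * δ ^ 2)))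
        - (√π * √π / π) * (c * (2 * V ^ 2 * δ ^ 2 * (3 / (4 * (c * β) ^ 5))))
        - √π * c * w := by
    field_simp
  rw [e1, e2, hsp, div_self hpi.ne', one_mul, one_mul] at hscaled
  rw [hsq]
  nlinarith

end SpinLaw

/-! ### The function `φ_L` -/

/-- Twice the mean spin of the `i`-th layer in the grand canonical state of activity `e^{t/2}`. -/
def polarization (q : ℝ) (L : ℕ) (t : ℝ) (i : Fin L) : ℝ :=
  Real.tanh ((t + 2 * (-Real.log q) * level L i) / 2)

/-- The variance of the magnetization of a stick. -/
def stickVariance (q : ℝ) (L : ℕ) (t : ℝ) : ℝ := spinVariance (polarization q L t)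

theorem hasDerivAt_tanh (x : ℝ) : HasDerivAt Real.tanh (1 - Real.tanh x ^ 2) x := by
  have h := (Real.hasDerivAt_sinh x).div (Real.hasDerivAt_cosh x) (Real.cosh_pos x).ne'
  have h2 : Real.tanh = fun x => Real.sinh x / Real.cosh x :=
    funext fun x => Real.tanh_eq_sinh_div_cosh x
  rw [h2]
  refine h.congr_deriv ?_
  have := (Real.cosh_pos x).ne'
  field_simp

theorem tanh_add_tanh (t c : ℝ) :
    Real.tanh ((t + c) / 2) + Real.tanh ((t + -c) / 2)
      = 2 * (Real.sinh t / (Real.cosh t + Real.cosh c)) := by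
  set a := (t + c) / 2 with ha
  set b := (t + -c) / 2 with hb
  have ht : t = a + b := by rw [ha, hb]; ring
  have hc : c = a - b := by rw [ha, hb]; ring
  rw [ht, hc, Real.sinh_add, Real.cosh_add, Real.cosh_sub, Real.tanh_eq_sinh_div_cosh,
    Real.tanh_eq_sinh_div_cosh]
  have h1 := (Real.cosh_pos a).ne'
  have h2 := (Real.cosh_pos b).ne'
  have h3 : Real.cosh a * Real.cosh b + Real.sinh a * Real.sinh b
      + (Real.cosh a * Real.cosh b - Real.sinh a * Real.sinh b) ≠ 0 := by
    ring_nf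
    positivity
  field_simp
  ring

theorem level_rev (L : ℕ) (i : Fin L) : level L i.rev = -level L i := by
  have : (((i.rev : ℕ) : ℝ)) = L - (i + 1) := by
    rw [Fin.val_rev, Nat.cast_sub (by omega)]
    push_cast
    ring
  simp only [level, this]
  ring

/-- Pairing the layers `l` and `-l` combines two hyperbolic tangents into one quotient. Thus
`φ_L⁻¹(t)` is the mean magnetization of a stick. -/
theorem phiInv_eq (q : ℝ) (L : ℕ) (t : ℝ) :
    phiInv q L t = 1 / 2 * ∑ i, polarization q L t i := by
  have h1 : ∑ i, polarization q L t i = ∑ i : Fin L, polarization q L t i.rev :=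
    (Equiv.sum_comp Fin.revPerm (polarization q L t)).symm
  have h2 : 2 * ∑ i, polarization q L t i = ∑ i : Fin L,
      2 * (Real.sinh t / (Real.cosh t + Real.cosh (2 * (-Real.log q) * level L i))) := by
    rw [two_mul]
    nth_rewrite 2 [h1]
    rw [← Finset.sum_add_distrib]
    refine Finset.sum_congr rfl fun i _ => ?_
    rw [← tanh_add_tanh, polarization, polarization, level_rev]
    ring_nf
  rw [← Finset.mul_sum] at h2
  rw [phiInv]
  linarith

theorem polarization_sq_lt_one (q : ℝ) (L : ℕ) (t : ℝ) (i : Fin L) :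
    polarization q L t i ^ 2 < 1 := Real.tanh_sq_lt_one _

theorem hasDerivAt_polarization (q : ℝ) (L : ℕ) (t : ℝ) (i : Fin L) :
    HasDerivAt (fun t => polarization q L t i) ((1 - polarization q L t i ^ 2) / 2) t := by
  have := (hasDerivAt_tanh ((t + 2 * (-Real.log q) * level L i) / 2)).comp t
    (((hasDerivAt_id t).add_const (2 * (-Real.log q) * level L i)).div_const 2)
  refine this.congr_deriv ?_
  rw [polarization]
  ring

theorem hasDerivAt_phiInv (q : ℝ) (L : ℕ) (t : ℝ) :
    HasDerivAt (phiInv q L) (stickVariance q L t) t := by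
  have h := (HasDerivAt.fun_sum (u := Finset.univ)
    fun i _ => hasDerivAt_polarization q L t i).const_mul (1 / 2)
  rw [show phiInv q L = fun t => 1 / 2 * ∑ i, polarization q L t i from
    funext fun t => phiInv_eq q L t]
  refine h.congr_deriv ?_
  rw [stickVariance, spinVariance, ← Finset.sum_div]
  ring

theorem stickVariance_pos (q : ℝ) {L : ℕ} (hL : 0 < L) (t : ℝ) : 0 < stickVariance q L t := by
  have : Nonempty (Fin L) := ⟨⟨0, hL⟩⟩
  have : 0 < ∑ i, (1 - polarization q L t i ^ 2) :=
    Finset.sum_pos (fun i _ => sub_pos.2 (polarization_sq_lt_one q L t i))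
      Finset.univ_nonempty
  rw [stickVariance, spinVariance]
  positivity

theorem hasDerivAt_stickVariance (q : ℝ) (L : ℕ) (t : ℝ) :
    HasDerivAt (stickVariance q L)
      (1 / 4 * ∑ i, -(polarization q L t i * (1 - polarization q L t i ^ 2))) t := by
  refine ((HasDerivAt.fun_sum (u := Finset.univ)
    fun i _ => ((hasDerivAt_polarization q L t i).pow 2).const_sub 1).const_mul (1 / 4)).congr_deriv ?_
  congr 1
  refine Finset.sum_congr rfl fun i _ => ?_
  push_cast
  ring

/-- Termwise from `|polarization| ≤ 1`. As the right side is also the derivative of `phiInv`, this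
yields the Lipschitz bound of the variance in the magnetization. -/
theorem abs_deriv_stickVariance_le (q : ℝ) (L : ℕ) (t : ℝ) :
    |1 / 4 * ∑ i, -(polarization q L t i * (1 - polarization q L t i ^ 2))|
      ≤ stickVariance q L t := by
  rw [stickVariance, spinVariance, abs_mul, abs_of_pos (by norm_num : (0 : ℝ) < 1 / 4)]
  refine mul_le_mul_of_nonneg_left ((Finset.abs_sum_le_sum_abs _ _).trans
    (Finset.sum_le_sum fun i _ => ?_)) (by norm_num)
  have h := polarization_sq_lt_one q L t i
  rw [abs_neg, abs_mul, abs_of_pos (sub_pos.2 h)]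
  refine mul_le_of_le_one_left (sub_pos.2 h).le ?_
  rw [← sq_le_one_iff_abs_le_one]
  exact h.le

theorem strictMono_phiInv (q : ℝ) {L : ℕ} (hL : 0 < L) : StrictMono (phiInv q L) :=
  strictMono_of_hasDerivAt_pos (fun t => hasDerivAt_phiInv q L t) fun t => stickVariance_pos q hL t

/-- The stick variance is a 1-Lipschitz function of the magnetization per stick. -/
theorem stickVariance_sub_le (q : ℝ) (L : ℕ) (s t : ℝ) :
    stickVariance q L t - stickVariance q L s ≤ |phiInv q L t - phiInv q L s| := by
  have hmono : Monotone fun t => phiInv q L t + stickVariance q L t :=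
    monotone_of_hasDerivAt_nonneg
      (fun t => (hasDerivAt_phiInv q L t).add (hasDerivAt_stickVariance q L t)) fun t => by
        have := (abs_le.1 (abs_deriv_stickVariance_le q L t)).1
        change (0 : ℝ) ≤ _
        linarith
  have hmono2 : Monotone fun t => phiInv q L t - stickVariance q L t :=
    monotone_of_hasDerivAt_nonneg
      (fun t => (hasDerivAt_phiInv q L t).sub (hasDerivAt_stickVariance q L t)) fun t => by
        have := (abs_le.1 (abs_deriv_stickVariance_le q L t)).2
        change (0 : ℝ) ≤ _
        linarith
  rcases le_total s t with h | h
  · have h1 := hmono2 h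
    have h2 := le_abs_self (phiInv q L t - phiInv q L s)
    simp only at h1
    linarith
  · have h1 := hmono h
    have h2 := neg_le_abs (phiInv q L t - phiInv q L s)
    simp only at h1
    linarith

theorem phiInv_mem_Ioo (q : ℝ) {L : ℕ} (hL : 0 < L) (t : ℝ) :
    phiInv q L t ∈ Set.Ioo (-((L : ℝ) / 2)) ((L : ℝ) / 2) := by
  have : Nonempty (Fin L) := ⟨⟨0, hL⟩⟩
  have h1 : ∑ i, polarization q L t i < ∑ _i : Fin L, (1 : ℝ) :=
    Finset.sum_lt_sum_of_nonempty Finset.univ_nonempty fun i _ => Real.tanh_lt_one _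
  have h2 : ∑ _i : Fin L, (-1 : ℝ) < ∑ i, polarization q L t i :=
    Finset.sum_lt_sum_of_nonempty Finset.univ_nonempty fun i _ => Real.neg_one_lt_tanh _
  simp only [Finset.sum_const, Finset.card_univ, Fintype.card_fin, nsmul_eq_mul] at h1 h2
  rw [phiInv_eq]
  constructor <;> linarith

theorem exists_phiInv_eq (q : ℝ) {L : ℕ} (hL : 0 < L) {m : ℝ}
    (hm : m ∈ Set.Ioo (-((L : ℝ) / 2)) ((L : ℝ) / 2)) : ∃ t, phiInv q L t = m := by
  have hL' : (0 : ℝ) < L := by exact_mod_cast hL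
  have hs : 2 * m / L ∈ Set.Ioo (-1 : ℝ) 1 := by
    constructor
    · rw [lt_div_iff₀ hL']; linarith [hm.1]
    · rw [div_lt_iff₀ hL']; linarith [hm.2]
  set a := Real.artanh (2 * m / L)
  have ha : Real.tanh a = 2 * m / L := Real.tanh_artanh hs
  have hmono : Monotone Real.tanh := monotone_of_hasDerivAt_nonneg hasDerivAt_tanh fun x =>
    sub_nonneg.2 (Real.tanh_sq_lt_one x).le
  -- `B` dominates every layer field, so at `2a - B` and `2a + B` all arguments of `tanh` lie on one
  -- side of `a`, and the intermediate value theorem applies.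
  set B := ∑ i : Fin L, |2 * (-Real.log q) * level L i| with hB
  have hBi : ∀ i : Fin L, |2 * (-Real.log q) * level L i| ≤ B := fun i =>
    Finset.single_le_sum (f := fun i : Fin L => |2 * (-Real.log q) * level L i|)
      (fun _ _ => abs_nonneg _) (Finset.mem_univ i)
  have hsum : m = 1 / 2 * ∑ _i : Fin L, 2 * m / L := by
    simp only [Finset.sum_const, Finset.card_univ, Fintype.card_fin, nsmul_eq_mul]
    field_simp
  have h := mem_range_of_exists_le_of_exists_ge (c := m) (f := phiInv q L)
    (continuous_iff_continuousAt.2 fun t => (hasDerivAt_phiInv q L t).continuousAt)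
    ⟨2 * a - B, by
      rw [phiInv_eq]
      conv_rhs => rw [hsum]
      refine mul_le_mul_of_nonneg_left (Finset.sum_le_sum fun i _ => ?_) (by norm_num)
      rw [← ha]
      exact hmono (by linarith [(abs_le.1 (hBi i)).2])⟩
    ⟨2 * a + B, by
      rw [phiInv_eq]
      conv_lhs => rw [hsum]
      refine mul_le_mul_of_nonneg_left (Finset.sum_le_sum fun i _ => ?_) (by norm_num)
      rw [← ha]
      exact hmono (by linarith [(abs_le.1 (hBi i)).1])⟩
  exact h

theorem phi_phiInv (q : ℝ) {L : ℕ} (hL : 0 < L) (t : ℝ) : phi q L (phiInv q L t) = t :=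
  Function.leftInverse_invFun (strictMono_phiInv q hL).injective t

theorem phiInv_phi (q : ℝ) {L : ℕ} (hL : 0 < L) {m : ℝ}
    (hm : m ∈ Set.Ioo (-((L : ℝ) / 2)) ((L : ℝ) / 2)) : phiInv q L (phi q L m) = m :=
  Function.invFun_eq (exists_phiInv_eq q hL hm)

/-- A strictly monotone function whose image is all of `ℝ` cannot jump. -/
theorem continuousAt_phi (q : ℝ) {L : ℕ} (hL : 0 < L) {m : ℝ}
    (hm : m ∈ Set.Ioo (-((L : ℝ) / 2)) ((L : ℝ) / 2)) : ContinuousAt (phi q L) m := by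
  have hmono : StrictMonoOn (phi q L) (Set.Ioo (-((L : ℝ) / 2)) ((L : ℝ) / 2)) := by
    intro x hx y hy hxy
    rw [← (strictMono_phiInv q hL).lt_iff_lt, phiInv_phi q hL hx, phiInv_phi q hL hy]
    exact hxy
  refine hmono.continuousAt_of_image_mem_nhds (Ioo_mem_nhds hm.1 hm.2) ?_
  convert Filter.univ_mem
  exact Set.eq_univ_of_forall fun t => ⟨phiInv q L t, phiInv_mem_Ioo q hL t, phi_phiInv q hL t⟩

theorem dphi_eq (q : ℝ) {L : ℕ} (hL : 0 < L) {m : ℝ}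
    (hm : m ∈ Set.Ioo (-((L : ℝ) / 2)) ((L : ℝ) / 2)) :
    dphi q L m = (stickVariance q L (phi q L m))⁻¹ := by
  refine (HasDerivAt.of_local_left_inverse (continuousAt_phi q hL hm)
    (hasDerivAt_phiInv q L (phi q L m)) (stickVariance_pos q hL _).ne' ?_).deriv
  filter_upwards [Ioo_mem_nhds hm.1 hm.2] with x hx
  exact phiInv_phi q hL hx

theorem continuousOn_dphi (q : ℝ) {L : ℕ} (hL : 0 < L) :
    ContinuousOn (dphi q L) (Set.Ioo (-((L : ℝ) / 2)) ((L : ℝ) / 2)) := by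
  refine ContinuousOn.congr (f := fun m => (stickVariance q L (phi q L m))⁻¹) ?_
    fun m hm => dphi_eq q hL hm
  intro m hm
  refine ContinuousAt.continuousWithinAt (ContinuousAt.inv₀ ?_ (stickVariance_pos q hL _).ne')
  exact (hasDerivAt_stickVariance q L _).continuousAt.comp (continuousAt_phi q hL hm)

/-! ### The `L^∞` norm on a ball. -/

theorem supNorm_nonneg (D : Set ℝ) (f : ℝ → ℝ) : 0 ≤ supNorm D f := ENNReal.toReal_nonneg

/-- If `f c` exceeded the essential supremum, continuity would make `f` exceed it on a nonempty open
set, which has positive measure. Compactness of the closed ball keeps the norm finite; otherwise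
`toReal` would return `0`. -/
theorem le_supNorm_ball {f : ℝ → ℝ} {c r : ℝ} (hr : 0 < r)
    (hf : ContinuousOn f (Metric.closedBall c r)) : f c ≤ supNorm (Metric.ball c r) f := by
  have hfin : eLpNorm f ⊤ (volume.restrict (Metric.ball c r)) ≠ ⊤ := by
    obtain ⟨C, hC⟩ := (isCompact_closedBall c r).exists_bound_of_continuousOn hf
    rw [eLpNorm_exponent_top]
    refine (eLpNormEssSup_lt_top_of_ae_bound (C := C) ?_).ne
    filter_upwards [ae_restrict_mem Metric.isOpen_ball.measurableSet] with x hx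
    exact hC x (Metric.ball_subset_closedBall hx)
  by_contra! hlt
  have hcont : ContinuousOn f (Metric.ball c r) := hf.mono Metric.ball_subset_closedBall
  set U := Metric.ball c r ∩ f ⁻¹' Set.Ioi (supNorm (Metric.ball c r) f) with hU
  have hUo : IsOpen U := hcont.isOpen_inter_preimage Metric.isOpen_ball isOpen_Ioi
  have hUn : U.Nonempty := ⟨c, Metric.mem_ball_self hr, hlt⟩
  have hpos := hUo.measure_pos volume hUn
  have hae : ∀ᵐ x ∂(volume.restrict (Metric.ball c r)), f x ≤ supNorm (Metric.ball c r) f := by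
    have h := ae_le_eLpNormEssSup (f := f) (μ := volume.restrict (Metric.ball c r))
    filter_upwards [h] with x hx
    rw [← eLpNorm_exponent_top] at hx
    have := ENNReal.toReal_mono hfin hx
    rw [toReal_enorm] at this
    exact (le_abs_self _).trans this
  rw [ae_restrict_iff' Metric.isOpen_ball.measurableSet] at hae
  refine hpos.ne' (measure_mono_null ?_ hae)
  intro x hx
  simp only [Set.mem_compl_iff, Set.mem_ofPred_eq, not_forall, not_le]
  exact ⟨hx.1, hx.2⟩

/-! ### Ground states -/

/-- The amplitude of a configuration in the canonical ground states. -/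
def amplitude (q : ℝ) {L n : ℕ} (σ : Config L n) : ℝ :=
  q ^ (∑ x : Site L n, (|level L x.1| / 2 - spin (σ x) * level L x.1))

theorem canState_apply (q : ℝ) (L n : ℕ) (M : ℝ) (σ : Config L n) [Decidable (magnetization σ = M)] :
    canState q L n M σ = if magnetization σ = M then (amplitude q σ : ℂ) else 0 := by
  simp only [canState, amplitude]
  congr

/-- The canonical partition function. -/
def canNorm (q : ℝ) (L n : ℕ) (M : ℝ) : ℝ := ‖canState q L n M‖ ^ 2

theorem magnetization_eq {L n : ℕ} (σ : Config L n) :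
    magnetization σ = ((Finset.univ.filter fun x => σ x = true).card : ℝ) - (L * n : ℝ) / 2 := by
  have h : ∀ x, spin (σ x) = (if σ x = true then (1 : ℝ) else 0) - 1 / 2 := fun x => by
    cases σ x <;> norm_num [spin]
  simp only [magnetization, h, Finset.sum_sub_distrib, Finset.sum_boole, Finset.sum_const,
    Finset.card_univ, Fintype.card_prod, Fintype.card_fin, nsmul_eq_mul]
  push_cast
  ring

theorem exists_magnetization_eq {L n k : ℕ} (hk : k ≤ L * n) :
    ∃ σ : Config L n, magnetization σ = (k : ℝ) - (L * n : ℝ) / 2 := by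
  obtain ⟨s, -, hs⟩ := Finset.exists_subset_card_eq (s := (Finset.univ : Finset (Site L n)))
    (n := k) (by simpa using hk)
  refine ⟨fun x => decide (x ∈ s), ?_⟩
  rw [magnetization_eq]
  simp [hs]

theorem exists_eq_magnetization {L n : ℕ} (σ : Config L n) :
    ∃ k ∈ Finset.range (L * n + 1), magnetization σ = (k : ℝ) - (L * n : ℝ) / 2 := by
  refine ⟨_, ?_, magnetization_eq σ⟩
  rw [Finset.mem_range, Nat.lt_succ_iff]
  refine (Finset.card_filter_le _ _).trans ?_
  simp

/-- Exponential tilting: at each site the weight is the corresponding factor of `F` times the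
probability of that spin value. -/
theorem amplitude_sq_mul_exp {q : ℝ} (hq : 0 < q) {L n : ℕ} (t : ℝ) (σ : Config L n) :
    amplitude q σ ^ 2 * Real.exp (t * magnetization σ)
      = F q L (Real.exp (t / 2)) ^ n
        * productWeight (fun x : Site L n => polarization q L t x.1) σ := by
  have hqe : ∀ y : ℝ, q ^ y = Real.exp (Real.log q * y) := fun y => Real.rpow_def_of_pos hq y
  have hF : F q L (Real.exp (t / 2)) ^ n = ∏ x : Site L n,
      (Real.exp (t / 2) * q ^ (|level L x.1| - level L x.1)
        + (Real.exp (t / 2))⁻¹ * q ^ (|level L x.1| + level L x.1)) := by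
    rw [Fintype.prod_prod_type]
    simp only [Finset.prod_const, Finset.card_univ, Fintype.card_fin, Finset.prod_pow, F]
  have hsite : ∀ x : Site L n, Real.exp (2 * (Real.log q
        * (|level L x.1| / 2 - spin (σ x) * level L x.1)) + t * spin (σ x))
      = (Real.exp (t / 2) * q ^ (|level L x.1| - level L x.1)
        + (Real.exp (t / 2))⁻¹ * q ^ (|level L x.1| + level L x.1))
        * ((1 + 2 * spin (σ x) * polarization q L t x.1) / 2) := fun x => by
    set l := level L x.1 with hl
    set a := (t + 2 * (-Real.log q) * l) / 2 with ha
    have h1 : Real.exp (t / 2) * q ^ (|l| - l) + (Real.exp (t / 2))⁻¹ * q ^ (|l| + l)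
        = Real.exp (Real.log q * |l|) * (Real.exp a + Real.exp (-a)) := by
      rw [hqe, hqe, ← Real.exp_neg, ← Real.exp_add, ← Real.exp_add,
        mul_add (Real.exp _), ← Real.exp_add, ← Real.exp_add, ha]
      congr 1 <;> congr 1 <;> ring
    have hp : 0 < Real.exp a + Real.exp (-a) := by positivity
    rw [h1, polarization, Real.tanh_eq, ← hl, ← ha]
    cases σ x
    · rw [spin_false, show 2 * (Real.log q * (|l| / 2 - -(1 / 2) * l)) + t * -(1 / 2)
        = Real.log q * |l| + -a by rw [ha]; ring, Real.exp_add]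
      field_simp
      ring
    · rw [spin_true, show 2 * (Real.log q * (|l| / 2 - 1 / 2 * l)) + t * (1 / 2)
        = Real.log q * |l| + a by rw [ha]; ring, Real.exp_add]
      field_simp
      ring
  rw [hF, productWeight, ← Finset.prod_mul_distrib]
  simp only [← hsite]
  rw [← Real.exp_sum, amplitude, hqe, ← Real.exp_nat_mul, ← Real.exp_add, magnetization,
    Finset.sum_add_distrib, ← Finset.mul_sum, ← Finset.mul_sum, ← Finset.mul_sum]
  push_cast
  rfl

theorem sum_productWeight {ι : Type*} [Fintype ι] [DecidableEq ι] (μ : ι → ℝ) :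
    ∑ σ : ι → Bool, productWeight μ σ = 1 := by
  have h := sum_productWeight_mul_exp μ 0
  simp only [spinChar, Complex.ofReal_zero, mul_zero, zero_mul, Complex.exp_zero, mul_one,
    Real.cos_zero, Real.sin_zero, Complex.ofReal_one, add_zero, Finset.prod_const_one] at h
  exact_mod_cast h

theorem F_pos {q : ℝ} (hq : 0 < q) (L : ℕ) {z : ℝ} (hz : 0 < z) : 0 < F q L z :=
  Finset.prod_pos fun i _ => by positivity

theorem canNorm_mul_exp {q : ℝ} (hq : 0 < q) (L n : ℕ) (t M : ℝ) :
    canNorm q L n M * Real.exp (t * M) = F q L (Real.exp (t / 2)) ^ n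
      * spinLaw (fun x : Site L n => polarization q L t x.1) M := by
  classical
  rw [canNorm, EuclideanSpace.norm_sq_eq, spinLaw, Finset.mul_sum, Finset.sum_mul]
  refine Finset.sum_congr rfl fun σ _ => ?_
  rw [canState_apply]
  by_cases h : magnetization σ = M
  · have h' : ∑ i, spin (σ i) = M := h
    rw [if_pos h, if_pos h', ← amplitude_sq_mul_exp hq, h, Complex.norm_real, Real.norm_eq_abs,
      sq_abs]
  · have h' : ¬ ∑ i, spin (σ i) = M := h
    rw [if_neg h, if_neg h']
    simp

theorem gcState_apply (q : ℝ) (L n : ℕ) (r : ℝ) (σ : Config L n) :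
    gcState q L n r σ = ((r ^ magnetization σ * amplitude q σ : ℝ) : ℂ) := by
  classical
  obtain ⟨k, hk, hσ⟩ := exists_eq_magnetization σ
  rw [gcState, WithLp.ofLp_sum, Finset.sum_apply, Finset.sum_eq_single k]
  · rw [PiLp.smul_apply, canState_apply, if_pos hσ, smul_eq_mul, hσ]
    push_cast
    rfl
  · intro j _ hj
    rw [PiLp.smul_apply, canState_apply, if_neg, smul_zero]
    rw [hσ]
    intro h
    exact hj (by exact_mod_cast (sub_left_injective h).symm)
  · exact fun h => absurd hk h

theorem norm_gcState_sq {q : ℝ} (hq : 0 < q) (L n : ℕ) (t : ℝ) :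
    ‖gcState q L n (Real.exp (t / 2))‖ ^ 2 = F q L (Real.exp (t / 2)) ^ n := by
  have h : ∀ σ : Config L n, ‖gcState q L n (Real.exp (t / 2)) σ‖ ^ 2
      = F q L (Real.exp (t / 2)) ^ n
        * productWeight (fun x : Site L n => polarization q L t x.1) σ := fun σ => by
    rw [gcState_apply, Complex.norm_real, Real.norm_eq_abs, sq_abs, ← amplitude_sq_mul_exp hq,
      mul_pow, ← Real.exp_mul, ← Real.exp_nat_mul, mul_comm]
    congr 2
    push_cast
    ring
  rw [EuclideanSpace.norm_sq_eq]
  simp only [h]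
  rw [← Finset.mul_sum, sum_productWeight, mul_one]

/-! ### Expectations -/

theorem totalSpin_apply {L n : ℕ} (ψ : Hilb L n) (σ : Config L n) :
    totalSpin L n ψ σ = magnetization σ * ψ σ := by
  rw [totalSpin, Matrix.ofLp_toEuclideanCLM, Matrix.mulVec_diagonal]

theorem totalSpin_canState (q : ℝ) (L n : ℕ) (M : ℝ) :
    totalSpin L n (canState q L n M) = (M : ℂ) • canState q L n M := by
  classical
  ext σ
  rw [totalSpin_apply, PiLp.smul_apply, canState_apply]
  split_ifs with h
  · rw [h, smul_eq_mul]
  · simp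

/-- `X` preserves the eigenspaces of the total spin, so distinct magnetization sectors do not mix.
-/
theorem inner_canState_eq_zero {q : ℝ} {L n : ℕ} {X : Obs L n} (hX : Commute X (totalSpin L n))
    {K K' : ℝ} (hK : K ≠ K') : inner ℂ (canState q L n K) (X (canState q L n K')) = 0 := by
  classical
  have h : totalSpin L n (X (canState q L n K')) = (K' : ℂ) • X (canState q L n K') := by
    have : X (totalSpin L n (canState q L n K')) = totalSpin L n (X (canState q L n K')) :=
      congrArg (fun Y : Obs L n => Y (canState q L n K')) hX.eq
    rw [← this, totalSpin_canState, map_smul]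
  rw [PiLp.inner_apply]
  refine Finset.sum_eq_zero fun σ _ => ?_
  rw [canState_apply]
  split_ifs with hσ
  · have h2 := congrArg (fun ψ : Hilb L n => ψ σ) h
    simp only [totalSpin_apply, PiLp.smul_apply, smul_eq_mul, hσ] at h2
    have h3 : ((K : ℂ) - K') * X (canState q L n K') σ = 0 := by
      rw [sub_mul, h2, sub_self]
    have h4 : (K : ℂ) - K' ≠ 0 := sub_ne_zero.2 (by exact_mod_cast hK)
    rw [(mul_eq_zero.1 h3).resolve_left h4, inner_zero_right]
  · rw [inner_zero_left]

theorem inner_gcState {q : ℝ} {L n : ℕ} {X : Obs L n} (hX : Commute X (totalSpin L n)) (t : ℝ) :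
    inner ℂ (gcState q L n (Real.exp (t / 2))) (X (gcState q L n (Real.exp (t / 2))))
      = ∑ k ∈ Finset.range (L * n + 1), (Real.exp (t * ((k : ℝ) - (L * n : ℝ) / 2)) : ℂ)
        * inner ℂ (canState q L n ((k : ℝ) - (L * n : ℝ) / 2))
          (X (canState q L n ((k : ℝ) - (L * n : ℝ) / 2))) := by
  rw [gcState, map_sum, sum_inner]
  refine Finset.sum_congr rfl fun k hk => ?_
  rw [inner_sum, Finset.sum_eq_single k]
  · rw [map_smul, inner_smul_left, inner_smul_right, Complex.conj_ofReal, ← mul_assoc,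
      ← Complex.ofReal_mul, ← Real.exp_mul, ← Real.exp_add]
    congr 3
    ring
  · intro j _ hj
    rw [map_smul, inner_smul_left, inner_smul_right, inner_canState_eq_zero hX, mul_zero, mul_zero]
    intro h
    exact hj (by exact_mod_cast (sub_left_injective h).symm)
  · exact fun h => absurd hk h

/-- Joining configurations of the first `n₀` sticks and of the others. -/
def configEquiv (L n₀ n' : ℕ) : Config L (n₀ + n') ≃ Config L n₀ × Config L n' where
  toFun σ := (fun x => σ (x.1, Fin.castAdd n' x.2), fun x => σ (x.1, Fin.natAdd n₀ x.2))
  invFun p x := Fin.addCases (fun j => p.1 (x.1, j)) (fun j => p.2 (x.1, j)) x.2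
  left_inv σ := by
    ext ⟨i, j⟩
    refine Fin.addCases (fun j => ?_) (fun j => ?_) j <;> simp
  right_inv p := by
    ext x <;> simp

theorem restrict_configEquiv_symm {L n₀ n' : ℕ} (h : n₀ ≤ n₀ + n') (τ : Config L n₀)
    (ρ : Config L n') : restrict h ((configEquiv L n₀ n').symm (τ, ρ)) = τ :=
  congrArg Prod.fst ((configEquiv L n₀ n').apply_symm_apply (τ, ρ))

theorem glue_configEquiv_symm {L n₀ n' : ℕ} (τ' τ : Config L n₀) (ρ : Config L n') :
    glue τ' ((configEquiv L n₀ n').symm (τ, ρ)) = (configEquiv L n₀ n').symm (τ', ρ) := by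
  ext ⟨i, j⟩
  refine Fin.addCases (fun j => ?_) (fun j => ?_) j <;> simp [glue, configEquiv]

theorem sum_site_configEquiv_symm {L n₀ n' : ℕ} (f : Fin L → Bool → ℝ) (τ : Config L n₀)
    (ρ : Config L n') :
    ∑ x : Site L (n₀ + n'), f x.1 ((configEquiv L n₀ n').symm (τ, ρ) x)
      = ∑ x, f x.1 (τ x) + ∑ x, f x.1 (ρ x) := by
  simp only [Fintype.sum_prod_type, Fin.sum_univ_add, Finset.sum_add_distrib]
  simp [configEquiv]

theorem magnetization_configEquiv_symm {L n₀ n' : ℕ} (τ : Config L n₀) (ρ : Config L n') :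
    magnetization ((configEquiv L n₀ n').symm (τ, ρ)) = magnetization τ + magnetization ρ :=
  sum_site_configEquiv_symm (fun _ b => spin b) τ ρ

theorem amplitude_configEquiv_symm {q : ℝ} (hq : 0 < q) {L n₀ n' : ℕ} (τ : Config L n₀)
    (ρ : Config L n') :
    amplitude q ((configEquiv L n₀ n').symm (τ, ρ)) = amplitude q τ * amplitude q ρ := by
  rw [amplitude, amplitude, amplitude, ← Real.rpow_add hq]
  congr 1
  exact sum_site_configEquiv_symm (fun i b => |level L i| / 2 - spin b * level L i) τ ρ

theorem canState_configEquiv_symm {q : ℝ} (hq : 0 < q) {L n₀ n' : ℕ} (M : ℝ) (τ : Config L n₀)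
    (ρ : Config L n') :
    canState q L (n₀ + n') M ((configEquiv L n₀ n').symm (τ, ρ))
      = amplitude q ρ * canState q L n₀ (M - magnetization ρ) τ := by
  classical
  rw [canState_apply, canState_apply, magnetization_configEquiv_symm,
    amplitude_configEquiv_symm hq]
  simp only [eq_sub_iff_add_eq]
  split_ifs
  · push_cast
    ring
  · simp

theorem inner_ampliate_canState {q : ℝ} (hq : 0 < q) {L n₀ n' : ℕ} (h : n₀ ≤ n₀ + n') (M : ℝ)
    (X : Obs L n₀) :
    inner ℂ (canState q L (n₀ + n') M) (ampliate h X (canState q L (n₀ + n') M))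
      = ∑ ρ : Config L n', ((amplitude q ρ ^ 2 : ℝ) : ℂ)
        * inner ℂ (canState q L n₀ (M - magnetization ρ))
          (X (canState q L n₀ (M - magnetization ρ))) := by
  rw [PiLp.inner_apply, ← (configEquiv L n₀ n').symm.sum_comp, Fintype.sum_prod_type,
    Finset.sum_comm]
  refine Finset.sum_congr rfl fun ρ _ => ?_
  rw [PiLp.inner_apply, Finset.mul_sum]
  refine Finset.sum_congr rfl fun τ _ => ?_
  have h1 : ampliate h X (canState q L (n₀ + n') M) ((configEquiv L n₀ n').symm (τ, ρ))
      = amplitude q ρ * X (canState q L n₀ (M - magnetization ρ)) τ := by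
    have h2 : (WithLp.toLp 2 fun τ' => canState q L (n₀ + n') M
        (glue τ' ((configEquiv L n₀ n').symm (τ, ρ))) : Hilb L n₀)
        = (amplitude q ρ : ℂ) • canState q L n₀ (M - magnetization ρ) := by
      ext τ'
      simp only [glue_configEquiv_symm, canState_configEquiv_symm hq, PiLp.smul_apply, smul_eq_mul]
    change X _ (restrict h _) = _
    rw [h2, map_smul, restrict_configEquiv_symm, PiLp.smul_apply, smul_eq_mul]
  rw [h1, canState_configEquiv_symm hq]
  simp only [RCLike.inner_apply, map_mul, Complex.conj_ofReal]
  push_cast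
  ring

theorem canState_eq_zero {q : ℝ} {L n : ℕ} {K : ℝ}
    (hK : ∀ k ∈ Finset.range (L * n + 1), K ≠ (k : ℝ) - (L * n : ℝ) / 2) :
    canState q L n K = 0 := by
  classical
  ext σ
  obtain ⟨k, hk, hσ⟩ := exists_eq_magnetization σ
  rw [canState_apply, if_neg]
  · rfl
  · exact fun h => hK k hk (h.symm.trans hσ)

/-- `X ⊗ 1` leaves the outer configuration fixed, and with the total `M` this fixes the inner
magnetization. Grouping outer configurations by magnetization collects their squared amplitudes into
`canNorm`. -/
theorem inner_ampliate_canState_eq_sum {q : ℝ} (hq : 0 < q) {L n₀ n' : ℕ} (h : n₀ ≤ n₀ + n')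
    (M : ℝ) (X : Obs L n₀) :
    inner ℂ (canState q L (n₀ + n') M) (ampliate h X (canState q L (n₀ + n') M))
      = ∑ k ∈ Finset.range (L * n₀ + 1), (canNorm q L n' (M - ((k : ℝ) - (L * n₀ : ℝ) / 2)) : ℂ)
        * inner ℂ (canState q L n₀ ((k : ℝ) - (L * n₀ : ℝ) / 2))
          (X (canState q L n₀ ((k : ℝ) - (L * n₀ : ℝ) / 2))) := by
  classical
  have hdecomp : ∀ K : ℝ, inner ℂ (canState q L n₀ K) (X (canState q L n₀ K))
      = ∑ k ∈ Finset.range (L * n₀ + 1), if K = (k : ℝ) - (L * n₀ : ℝ) / 2 then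
        inner ℂ (canState q L n₀ ((k : ℝ) - (L * n₀ : ℝ) / 2))
          (X (canState q L n₀ ((k : ℝ) - (L * n₀ : ℝ) / 2))) else 0 := fun K => by
    by_cases hK : ∃ k ∈ Finset.range (L * n₀ + 1), K = (k : ℝ) - (L * n₀ : ℝ) / 2
    · obtain ⟨k, hk, rfl⟩ := hK
      rw [Finset.sum_eq_single k]
      · rw [if_pos rfl]
      · intro j _ hj
        rw [if_neg]
        intro h
        exact hj (by exact_mod_cast (sub_left_injective h).symm)
      · exact fun h => absurd hk h
    · push Not at hK
      rw [canState_eq_zero hK, inner_zero_left]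
      exact (Finset.sum_eq_zero fun k hk => if_neg (hK k hk)).symm
  rw [inner_ampliate_canState hq]
  simp only [hdecomp (M - _), Finset.mul_sum]
  rw [Finset.sum_comm]
  refine Finset.sum_congr rfl fun k _ => ?_
  rw [canNorm, EuclideanSpace.norm_sq_eq]
  push_cast
  rw [Finset.sum_mul]
  refine Finset.sum_congr rfl fun ρ _ => ?_
  rw [canState_apply]
  have hiff : M - magnetization ρ = (k : ℝ) - (L * n₀ : ℝ) / 2
      ↔ magnetization ρ = M - ((k : ℝ) - (L * n₀ : ℝ) / 2) := by
    constructor <;> intro h <;> linarith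
  simp only [hiff]
  split_ifs
  · rw [Complex.norm_real, Real.norm_eq_abs, ← Complex.ofReal_pow, ← Complex.ofReal_pow, sq_abs]
  · simp

theorem ampliate_one {L n₀ n : ℕ} (h : n₀ ≤ n) (ψ : Hilb L n) : ampliate h 1 ψ = ψ := by
  ext σ
  have hσ : glue (restrict h σ) σ = σ := by
    funext x
    simp [glue, restrict]
  change ψ (glue (restrict h σ) σ) = ψ σ
  rw [hσ]

/-! ### Comparison of expectations -/

/-- For normalized weights, `a ≤ (1 + E) b` gives `|a - b| ≤ 2E b - (a - b)`. The difference `a - b`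
has total zero, so no lower bound on `a` is needed. -/
theorem norm_weighted_mean_sub_le {ι : Type*} {s : Finset ι} {A B Z : ι → ℝ} {x : ι → ℂ}
    {C E SA SB : ℝ} (hE : 0 ≤ E) (hB : ∀ k ∈ s, 0 ≤ B k)
    (hx : ∀ k ∈ s, ‖x k‖ ≤ C * Z k) (hSA : ∑ k ∈ s, A k * Z k = SA)
    (hSB : ∑ k ∈ s, B k * Z k = SB) (hSA0 : 0 < SA) (hSB0 : 0 < SB)
    (hAB : ∀ k ∈ s, A k * SB ≤ (1 + E) * (B k * SA)) :
    ‖(∑ k ∈ s, (A k : ℂ) * x k) / SA - (∑ k ∈ s, (B k : ℂ) * x k) / SB‖ ≤ 2 * E * C := by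
  have h1 : (∑ k ∈ s, (A k : ℂ) * x k) / SA - (∑ k ∈ s, (B k : ℂ) * x k) / SB
      = ∑ k ∈ s, ((A k / SA - B k / SB : ℝ) : ℂ) * x k := by
    rw [Finset.sum_div, Finset.sum_div, ← Finset.sum_sub_distrib]
    refine Finset.sum_congr rfl fun k _ => ?_
    push_cast
    ring
  have h2 : ∀ k ∈ s, |A k / SA - B k / SB| ≤ 2 * E * (B k / SB) - (A k / SA - B k / SB) := by
    intro k hk
    have ha : A k / SA ≤ (1 + E) * (B k / SB) := by
      rw [div_le_iff₀ hSA0]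
      have := hAB k hk
      rw [← le_div_iff₀ hSB0] at this
      refine this.trans (le_of_eq ?_)
      ring
    have hb : 0 ≤ B k / SB := div_nonneg (hB k hk) hSB0.le
    have := mul_nonneg hE hb
    rw [abs_le]
    constructor <;> linarith
  rw [h1]
  calc _ ≤ ∑ k ∈ s, ‖((A k / SA - B k / SB : ℝ) : ℂ) * x k‖ := norm_sum_le _ _
    _ ≤ ∑ k ∈ s, (2 * E * (B k / SB) - (A k / SA - B k / SB)) * (C * Z k) := by
        refine Finset.sum_le_sum fun k hk => ?_
        rw [norm_mul, Complex.norm_real, Real.norm_eq_abs]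
        exact mul_le_mul (h2 k hk) (hx k hk) (norm_nonneg _)
          ((abs_nonneg _).trans (h2 k hk))
    _ = C * ((2 * E + 1) * ((∑ k ∈ s, B k * Z k) / SB) - (∑ k ∈ s, A k * Z k) / SA) := by
        rw [Finset.sum_div, Finset.sum_div, Finset.mul_sum, ← Finset.sum_sub_distrib,
          Finset.mul_sum]
        refine Finset.sum_congr rfl fun k _ => ?_
        ring
    _ = 2 * E * C := by
        rw [hSA, hSB, div_self hSA0.ne', div_self hSB0.ne']
        ring

/-- If no relevant value of the magnetization outside `Λ(L,n₀)` is much more likely than the given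
value of the total magnetization, then the two ensembles are close. -/
theorem norm_canExp_sub_gcExp_le {q : ℝ} (hq : 0 < q) {L n₀ n' : ℕ} (h : n₀ ≤ n₀ + n')
    {X : Obs L n₀} (hX : Commute X (totalSpin L n₀)) (t M : ℝ) {E : ℝ} (hE : 0 ≤ E)
    (hM : 0 < spinLaw (fun x : Site L (n₀ + n') => polarization q L t x.1) M)
    (hP : ∀ k ∈ Finset.range (L * n₀ + 1),
      spinLaw (fun x : Site L n' => polarization q L t x.1) (M - ((k : ℝ) - (L * n₀ : ℝ) / 2))
      ≤ (1 + E) * spinLaw (fun x : Site L (n₀ + n') => polarization q L t x.1) M) :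
    ‖canExp q h M X - gcExp q (Real.exp (t / 2)) X‖ ≤ 2 * E * ‖X‖ := by
  have hF := F_pos hq L (Real.exp_pos (t / 2))
  have hcan := canNorm_mul_exp hq L (n₀ + n') t M
  have hSA0 : 0 < canNorm q L (n₀ + n') M :=
    pos_of_mul_pos_left (by rw [hcan]; positivity) (Real.exp_pos _).le
  have hinner : ∀ {n : ℕ} (ψ : Hilb L n), inner ℂ ψ ψ = ((‖ψ‖ ^ 2 : ℝ) : ℂ) := fun ψ => by
    rw [inner_self_eq_norm_sq_to_K]
    push_cast
    rfl
  rw [canExp, gcExp, expectation, expectation, inner_ampliate_canState_eq_sum hq]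
  have hgc := inner_gcState (q := q) hX t
  rw [ContinuousLinearMap.coe_coe, hgc]
  refine norm_weighted_mean_sub_le (s := Finset.range (L * n₀ + 1))
    (A := fun k => canNorm q L n' (M - ((k : ℝ) - (L * n₀ : ℝ) / 2)))
    (B := fun k => Real.exp (t * ((k : ℝ) - (L * n₀ : ℝ) / 2)))
    (Z := fun k => canNorm q L n₀ ((k : ℝ) - (L * n₀ : ℝ) / 2))
    hE (fun k _ => (Real.exp_pos _).le) ?_ ?_ ?_ hSA0 ?_ ?_
  · intro k _
    refine (norm_inner_le_norm _ _).trans ?_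
    have := X.le_opNorm (canState q L n₀ ((k : ℝ) - (L * n₀ : ℝ) / 2))
    have h2 := mul_le_mul_of_nonneg_left this
      (norm_nonneg (canState q L n₀ ((k : ℝ) - (L * n₀ : ℝ) / 2)))
    refine h2.trans (le_of_eq ?_)
    rw [canNorm]
    ring
  · have h1 := inner_ampliate_canState_eq_sum hq h M (1 : Obs L n₀)
    rw [ampliate_one, hinner] at h1
    simp only [one_apply_eq_self, hinner] at h1
    exact_mod_cast h1.symm
  · have h1 := inner_gcState (q := q) (Commute.one_left (totalSpin L n₀)) t
    simp only [one_apply_eq_self, hinner] at h1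
    exact_mod_cast h1.symm
  · rw [norm_gcState_sq hq]
    positivity
  · intro k hk
    set K := (k : ℝ) - (L * n₀ : ℝ) / 2
    have h1 := canNorm_mul_exp hq L n' t (M - K)
    rw [norm_gcState_sq hq]
    change _ ≤ (1 + E) * (Real.exp (t * K) * canNorm q L (n₀ + n') M)
    have hexp : Real.exp (t * M) = Real.exp (t * (M - K)) * Real.exp (t * K) := by
      rw [← Real.exp_add]
      ring_nf
    have hpos := Real.exp_pos (t * (M - K))
    -- Multiplying by `e^{t(M-K)}` turns both canonical norms into probabilities.
    refine le_of_mul_le_mul_right ?_ hpos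
    calc _ = (canNorm q L n' (M - K) * Real.exp (t * (M - K))) * F q L (Real.exp (t / 2)) ^ n₀ := by
          ring
      _ = F q L (Real.exp (t / 2)) ^ (n₀ + n')
          * spinLaw (fun x : Site L n' => polarization q L t x.1) (M - K) := by
          rw [h1, pow_add]
          ring
      _ ≤ F q L (Real.exp (t / 2)) ^ (n₀ + n')
          * ((1 + E) * spinLaw (fun x : Site L (n₀ + n') => polarization q L t x.1) M) :=
          mul_le_mul_of_nonneg_left (hP k hk) (by positivity)
      _ = (1 + E) * (canNorm q L (n₀ + n') M * Real.exp (t * M)) := by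
          rw [hcan]
          ring
      _ = _ := by
          rw [hexp]
          ring

/-! ### The error terms -/

theorem sum_site_polarization (q : ℝ) (L n : ℕ) (t : ℝ) (f : ℝ → ℝ) :
    ∑ x : Site L n, f (polarization q L t x.1) = n * ∑ i, f (polarization q L t i) := by
  simp only [Fintype.sum_prod_type, Finset.sum_const, Finset.card_univ, Fintype.card_fin,
    nsmul_eq_mul, Finset.mul_sum]

theorem spinVariance_site (q : ℝ) (L n : ℕ) (t : ℝ) :
    spinVariance (fun x : Site L n => polarization q L t x.1) = n * stickVariance q L t := by
  rw [stickVariance, spinVariance, spinVariance, sum_site_polarization q L n t fun a => 1 - a ^ 2]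
  ring

theorem mean_site (q : ℝ) (L n : ℕ) (t : ℝ) :
    1 / 2 * ∑ x : Site L n, polarization q L t x.1 = phiInv q L t * n := by
  rw [phiInv_eq, sum_site_polarization q L n t fun a => a]
  ring

theorem spinLaw_pos {ι : Type*} [Fintype ι] [DecidableEq ι] {μ : ι → ℝ} (hμ : ∀ i, μ i ^ 2 < 1)
    {M : ℝ} (hM : ∃ τ : ι → Bool, ∑ i, spin (τ i) = M) : 0 < spinLaw μ M := by
  obtain ⟨τ, hτ⟩ := hM
  refine Finset.sum_pos' (fun σ _ => ?_) ⟨τ, Finset.mem_univ τ, ?_⟩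
  · split_ifs
    · exact productWeight_nonneg (fun i => (hμ i).le) σ
    · exact le_rfl
  · rw [if_pos hτ]
    refine Finset.prod_pos fun i _ => ?_
    have := abs_lt.1 ((sq_lt_one_iff_abs_lt_one _).1 (hμ i))
    cases τ i
    · rw [spin_false]; linarith
    · rw [spin_true]; linarith

/-- Convexity: the chord on `[0, 3/2]` has slope at most `(9/2 - 1) / (3/2) = 7/3`, since `e³ ≤
81/4`. -/
theorem exp_le_chord {w : ℝ} (h0 : 0 ≤ w) (h1 : w ≤ 3 / 2) : Real.exp w ≤ 1 + 7 / 3 * w := by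
  have he : Real.exp (3 / 2) ≤ 9 / 2 := by
    refine le_of_sq_le_sq ?_ (by norm_num)
    rw [← Real.exp_nat_mul, show ((2 : ℕ) : ℝ) * (3 / 2) = ((3 : ℕ) : ℝ) * 1 by norm_num,
      Real.exp_nat_mul]
    have := pow_le_pow_left₀ (Real.exp_pos 1).le Real.exp_one_lt_d9.le 3
    norm_num at this ⊢
    linarith
  have h := convexOn_exp.2 (Set.mem_univ 0) (Set.mem_univ (3 / 2 : ℝ))
    (show 0 ≤ 1 - w / (3 / 2) by linarith) (show 0 ≤ w / (3 / 2) by positivity) (by ring)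
  simp only [smul_eq_mul, mul_zero, zero_add, Real.exp_zero, mul_one] at h
  rw [div_mul_cancel₀ _ (by norm_num)] at h
  have := mul_le_mul_of_nonneg_left he (show 0 ≤ w / (3 / 2) by positivity)
  linarith

/-- The local limit bound is only useful if the variance is not too small. -/
theorem le_variance_of_lt_one {d V : ℝ} (hd0 : 0 < d) (hd1 : d ≤ 1) (hV : 0 < V)
    (h : d + (1 + √(2 * Real.pi * V)) * Real.exp (-(2 * V) * (d * (1 - d / 6) ^ 2)) < 1) :
    3 / 2 ≤ 2 * V * d := by
  set w := 2 * V * (d * (1 - d / 6) ^ 2) with hw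
  have hβ : 0 < 1 - d / 6 := by linarith
  have hw0 : 0 < w := by positivity
  have hwle : w ≤ 2 * V * d := by
    have : (1 - d / 6) ^ 2 ≤ 1 := by nlinarith
    have := mul_le_mul_of_nonneg_left this (show 0 ≤ 2 * V * d by positivity)
    rw [hw]
    linarith
  refine le_trans ?_ hwle
  -- If `w < 3/2`, the chord bound gives `√(2πV) < (1 - d)(7/3)w`. Squaring, with `3w ≤ 2πVd` and
  -- `d(1 - d)² ≤ 1/4`, forces `w > 108/49 > 3/2`.
  by_contra! hlt
  have he := exp_le_chord hw0.le hlt.le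
  rw [show -(2 * V) * (d * (1 - d / 6) ^ 2) = -w by rw [hw]; ring, Real.exp_neg] at h
  have h1 : 1 + √(2 * Real.pi * V) < (1 - d) * Real.exp w := by
    rw [← div_lt_iff₀ (Real.exp_pos w), div_eq_mul_inv]
    linarith
  have h2 : √(2 * Real.pi * V) < (1 - d) * (7 / 3 * w) := by
    nlinarith [mul_le_mul_of_nonneg_left he (sub_nonneg.2 hd1)]
  have h3 : 2 * Real.pi * V < ((1 - d) * (7 / 3 * w)) ^ 2 :=
    (Real.sqrt_lt' ((Real.sqrt_nonneg _).trans_lt h2)).1 h2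
  have h4 : 3 * w ≤ 2 * Real.pi * V * d := by
    have := Real.pi_gt_three
    nlinarith [mul_pos hV hd0]
  have h5 : d * (1 - d) ≤ 1 / 4 := by nlinarith [sq_nonneg (d - 1 / 2)]
  have h6 : d * (1 - d) ^ 2 ≤ 1 / 4 := by
    have := mul_le_mul_of_nonneg_right h5 (sub_nonneg.2 hd1)
    nlinarith
  have h7 : d * ((1 - d) * (7 / 3 * w)) ^ 2 ≤ 1 / 4 * (49 / 9 * w ^ 2) := by
    have := mul_le_mul_of_nonneg_right h6 (show 0 ≤ 49 / 9 * w ^ 2 by positivity)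
    nlinarith
  nlinarith [mul_lt_mul_of_pos_left h3 hd0]

theorem epsLower_nonneg (q : ℝ) (L n : ℕ) (ε m : ℝ) : 0 ≤ epsLower q L n ε m := by
  unfold epsLower
  positivity

/-- The left side is the error of `spinLaw_lower` for `δ² = d` and variance `n y`; the nonnegative
middle term of `epsLower` is dropped. -/
theorem le_epsLower {q : ℝ} {L n : ℕ} (hn : 0 < n) {ε m y d : ℝ} (hy : dphi q L m = y⁻¹)
    (hd : d = (n : ℝ) ^ (-1 + 2 * ε)) :
    d + (1 + √(2 * Real.pi * (n * y))) * Real.exp (-(2 * (n * y)) * (d * (1 - d / 6) ^ 2))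
      ≤ epsLower q L n ε m := by
  have hn0 : (0 : ℝ) < n := by exact_mod_cast hn
  have h2 : (n : ℝ) ^ (2 * ε) = n * d := by
    rw [hd]
    nth_rewrite 2 [← Real.rpow_one (n : ℝ)]
    rw [← Real.rpow_add hn0]
    ring_nf
  have h3 : 0 ≤ 4 * (n : ℝ) ^ (-1 + 4 * ε) * (m * dphi q L m) ^ 2
      / (1 - 2 * (n : ℝ) ^ (-1 + 2 * ε)) ^ 4 := by positivity
  have h4 : √(2 * Real.pi * n / dphi q L m) = √(2 * Real.pi * (n * y)) := by
    rw [hy, div_inv_eq_mul, mul_assoc]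
  have h5 : -2 * (n : ℝ) ^ (2 * ε) * (1 - 1 / 6 * (n : ℝ) ^ (-1 + 2 * ε)) ^ 2 / dphi q L m
      = -(2 * (n * y)) * (d * (1 - d / 6) ^ 2) := by
    rw [hy, div_inv_eq_mul, h2, ← hd]
    ring
  rw [epsLower, h4, h5, ← hd]
  rw [← hd] at h3
  linarith

theorem E₁_nonneg {q : ℝ} (hq0 : 0 < q) (hq1 : q < 1) (L n₀ n : ℕ) {m ε₂ : ℝ}
    (hgeom : Real.exp |phi q L m| * q ^ (2 * (n : ℝ) ^ ε₂) < 1) : 0 ≤ E₁ q L n₀ n m ε₂ := by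
  have h1 : 0 ≤ ∑' k : ℤ, q ^ (k ^ 2) := tsum_nonneg fun k => by positivity
  have hfac : ∀ k : ℕ, 0 ≤ 1 - q ^ (2 * (k + 1)) := fun k =>
    sub_nonneg.2 (pow_le_one₀ hq0.le hq1.le)
  have h2 : 0 ≤ ∏' k : ℕ, (1 - q ^ (2 * (k + 1))) := by
    -- The sign needs no convergence proof: a product that is not multipliable has the default value
    -- `1`.
    by_cases h : Multipliable fun k : ℕ => (1 - q ^ (2 * (k + 1)))
    · exact ge_of_tendsto' h.hasProd fun s => Finset.prod_nonneg fun k _ => hfac k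
    · rw [tprod_eq_one_of_not_multipliable h]
      exact zero_le_one
  have h3 := F_pos hq0 L (Real.exp_pos (phi q L m / 2))
  have h4 := sub_pos.2 hgeom
  rw [E₁]
  positivity

/-- The first of the two quantities in `ℰ₂`, plus one. -/
def upperFactor (q : ℝ) (L n₀ n : ℕ) (m ε ε₂ : ℝ) : ℝ :=
  Real.sqrt (1 + n₀ / ((n : ℝ) - n₀))
    * Real.sqrt (1 + supNorm (Metric.ball (centerD n₀ n m) (radiusD n₀ n ε₂)) (ddphi q L)
      / dphi q L m * ((|m| + (n : ℝ) ^ ε₂) * n₀ / ((n : ℝ) - n₀)))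
    * Real.exp (1 / 2 * supNorm (Metric.ball (centerD n₀ n m) (radiusD n₀ n ε₂)) (dphi q L)
      * ((|m| + (n : ℝ) ^ ε₂) ^ 2 * (n₀ : ℝ) ^ 2 / ((n : ℝ) - n₀)))
    * ((1 + supNorm (Metric.ball (centerD n₀ n m) (radiusD n₀ n ε₂)) (epsUpper q L (n - n₀) ε))
      / (1 - epsLower q L n ε m))

theorem upperFactor_le (q : ℝ) (L n₀ n : ℕ) (m ε ε₂ : ℝ) :
    upperFactor q L n₀ n m ε ε₂ ≤ 1 + E₂ q L n₀ n m ε ε₂ := by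
  have : upperFactor q L n₀ n m ε ε₂ - 1 ≤ E₂ q L n₀ n m ε ε₂ := le_max_left _ _
  linarith

/-- The factors with `φ_L''` and `ε_upper` are at least `1` and are discarded. -/
theorem le_upperFactor {q : ℝ} {L n₀ n : ℕ} (hn : n₀ < n) {m ε ε₂ : ℝ} (hφ : 0 < dphi q L m)
    (hlow : epsLower q L n ε m < 1) :
    Real.sqrt (1 + n₀ / ((n : ℝ) - n₀))
      * Real.exp (1 / 2 * supNorm (Metric.ball (centerD n₀ n m) (radiusD n₀ n ε₂)) (dphi q L)
        * ((|m| + (n : ℝ) ^ ε₂) ^ 2 * (n₀ : ℝ) ^ 2 / ((n : ℝ) - n₀)))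
      / (1 - epsLower q L n ε m) ≤ upperFactor q L n₀ n m ε ε₂ := by
  have hd : (0 : ℝ) < (n : ℝ) - n₀ := sub_pos.2 (by exact_mod_cast hn)
  set D := Metric.ball (centerD n₀ n m) (radiusD n₀ n ε₂) with hD
  have h1 : 1 ≤ Real.sqrt (1 + supNorm D (ddphi q L) / dphi q L m
      * ((|m| + (n : ℝ) ^ ε₂) * n₀ / ((n : ℝ) - n₀))) := by
    rw [Real.one_le_sqrt]
    have := supNorm_nonneg D (ddphi q L)
    have : 0 ≤ supNorm D (ddphi q L) / dphi q L m
      * ((|m| + (n : ℝ) ^ ε₂) * n₀ / ((n : ℝ) - n₀)) := by positivity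
    linarith
  have h2 := supNorm_nonneg D (epsUpper q L (n - n₀) ε)
  have h3 := sub_pos.2 hlow
  rw [upperFactor, ← hD]
  refine le_of_le_of_eq ?_ (mul_div_assoc _ _ _)
  refine div_le_div_of_nonneg_right ?_ h3.le
  set s := Real.sqrt (1 + n₀ / ((n : ℝ) - n₀))
  set e := Real.exp (1 / 2 * supNorm D (dphi q L)
        * ((|m| + (n : ℝ) ^ ε₂) ^ 2 * (n₀ : ℝ) ^ 2 / ((n : ℝ) - n₀)))
  have hs : 0 ≤ s := Real.sqrt_nonneg _
  have he : 0 < e := Real.exp_pos _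
  calc s * e = s * 1 * e * 1 := by ring
    _ ≤ _ := by
      gcongr
      linarith

theorem one_le_upperFactor {q : ℝ} {L n₀ n : ℕ} (hn : n₀ < n) {m ε ε₂ : ℝ}
    (hφ : 0 < dphi q L m) (hlow : epsLower q L n ε m < 1) :
    1 ≤ upperFactor q L n₀ n m ε ε₂ := by
  refine le_trans ?_ (le_upperFactor hn hφ hlow)
  have hd : (0 : ℝ) < (n : ℝ) - n₀ := sub_pos.2 (by exact_mod_cast hn)
  rw [one_le_div (sub_pos.2 hlow)]
  have h1 : 1 ≤ Real.sqrt (1 + n₀ / ((n : ℝ) - n₀)) := by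
    rw [Real.one_le_sqrt]
    have : 0 ≤ n₀ / ((n : ℝ) - n₀) := by positivity
    linarith
  have h2 : 1 ≤ Real.exp (1 / 2
      * supNorm (Metric.ball (centerD n₀ n m) (radiusD n₀ n ε₂)) (dphi q L)
        * ((|m| + (n : ℝ) ^ ε₂) ^ 2 * (n₀ : ℝ) ^ 2 / ((n : ℝ) - n₀))) := by
    rw [Real.one_le_exp_iff]
    have := supNorm_nonneg (Metric.ball (centerD n₀ n m) (radiusD n₀ n ε₂)) (dphi q L)
    positivity
  have := one_le_mul_of_one_le_of_one_le h1 h2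
  linarith [epsLower_nonneg q L n ε m]

/-- The source of `0.708` in the bounds on `δ²`: a number just above `1/√2`. -/
theorem rpow_le_of_two_le {n : ℕ} (hn : 2 ≤ n) {ε : ℝ} (hε : ε < 1 / 4) :
    (n : ℝ) ^ (-1 + 2 * ε) ≤ 0.708 := by
  have hn2 : (2 : ℝ) ≤ n := by exact_mod_cast hn
  calc (n : ℝ) ^ (-1 + 2 * ε) ≤ (n : ℝ) ^ (-(1 / 2) : ℝ) :=
        Real.rpow_le_rpow_of_exponent_le (by linarith) (by linarith)
    _ ≤ (2 : ℝ) ^ (-(1 / 2) : ℝ) :=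
        Real.rpow_le_rpow_of_nonpos (by norm_num) hn2 (by norm_num)
    _ = (√2)⁻¹ := by rw [Real.rpow_neg (by norm_num), Real.sqrt_eq_rpow]
    _ ≤ 0.708 := by
        rw [inv_le_comm₀ (by positivity) (by norm_num)]
        refine Real.le_sqrt_of_sq_le ?_
        norm_num

/-- A lower bound for the variance of a stick in the regime where `ε_lower < 1`. -/
theorem one_le_stickVariance_mul {n₀ n' : ℕ} (hn₀ : 0 < n₀) (hn' : 0 < n') {ε y : ℝ}
    (hε : ε < 1 / 4)
    (h : 3 / 2 ≤ 2 * (((n₀ + n' : ℕ) : ℝ) * y) * ((n₀ + n' : ℕ) : ℝ) ^ (-1 + 2 * ε)) :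
    1 ≤ 2 * y * (n₀ * n') := by
  set N : ℝ := ((n₀ + n' : ℕ) : ℝ) with hN
  have h1 : (1 : ℝ) ≤ n₀ := by exact_mod_cast hn₀
  have h2 : (1 : ℝ) ≤ n' := by exact_mod_cast hn'
  have hN2 : N = n₀ + n' := by rw [hN]; push_cast; rfl
  have hN0 : 0 < N := by linarith
  have hpow : N * N ^ (-1 + 2 * ε) ≤ √N := by
    nth_rewrite 1 [← Real.rpow_one N]
    rw [← Real.rpow_add hN0, Real.sqrt_eq_rpow]
    exact Real.rpow_le_rpow_of_exponent_le (by linarith) (by linarith)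
  have hy : 0 < y := by
    by_contra! hy
    have : 0 < N * N ^ (-1 + 2 * ε) := by positivity
    nlinarith
  -- It remains to compare `√N` with `(3/2) n₀ n'`, which holds since `n₀ + n' ≤ n₀ n' + 1`.
  have h3 : 3 / 2 ≤ 2 * y * √N := by nlinarith
  have h4 : √N ≤ 3 / 2 * (n₀ * n') := by
    rw [Real.sqrt_le_left (by positivity), hN2]
    have h5 : (n₀ : ℝ) + n' ≤ n₀ * n' + 1 := by nlinarith
    have h6 : (1 : ℝ) ≤ n₀ * n' := one_le_mul_of_one_le_of_one_le h1 h2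
    nlinarith
  nlinarith

/-- By `1 + x ≤ e^x` and `φ_L' = 1/variance` at the centre `c` of `𝒟`, it suffices that the variance
`yc` at `c` is at most `y(|m| + N)² n₀²`, where `y` is the variance at `m`. The Lipschitz bound
gives `yc ≤ y + |m| n₀/n'`. Then `n₀/n' ≤ 2y n₀²` by `hy`, and `1 + 2|m| ≤ (|m| + N)²` because `N ≥
1`. -/
theorem one_add_le_exp_supNorm {q : ℝ} {L n₀ n' : ℕ} (hL : 0 < L) (hn₀ : 0 < n₀) (hn' : 0 < n')
    {m ε₂ : ℝ} (hm : m ∈ Set.Ioo (-((L : ℝ) / 2)) ((L : ℝ) / 2)) (hε₂ : 0 < ε₂)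
    (hD : Metric.closedBall (centerD n₀ (n₀ + n') m) (radiusD n₀ (n₀ + n') ε₂)
      ⊆ Set.Ioo (-((L : ℝ) / 2)) ((L : ℝ) / 2))
    (hy : 1 ≤ 2 * stickVariance q L (phi q L m) * (n₀ * n')) :
    1 + 1 / (2 * (n' * stickVariance q L (phi q L m)))
      ≤ Real.exp (1 / 2 * supNorm (Metric.ball (centerD n₀ (n₀ + n') m)
          (radiusD n₀ (n₀ + n') ε₂)) (dphi q L)
        * ((|m| + ((n₀ + n' : ℕ) : ℝ) ^ ε₂) ^ 2 * (n₀ : ℝ) ^ 2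
          / (((n₀ + n' : ℕ) : ℝ) - n₀))) := by
  have h1 : (1 : ℝ) ≤ n₀ := by exact_mod_cast hn₀
  have h2 : (1 : ℝ) ≤ n' := by exact_mod_cast hn'
  have hsub : ((n₀ + n' : ℕ) : ℝ) - n₀ = n' := by push_cast; ring
  have hN : 1 ≤ ((n₀ + n' : ℕ) : ℝ) ^ ε₂ := Real.one_le_rpow (by push_cast; linarith) hε₂.le
  set N := ((n₀ + n' : ℕ) : ℝ) ^ ε₂ with hNdef
  set c := centerD n₀ (n₀ + n') m with hc
  have hr : 0 < radiusD n₀ (n₀ + n') ε₂ := by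
    rw [radiusD, hsub]
    positivity
  have hcmem : c ∈ Set.Ioo (-((L : ℝ) / 2)) ((L : ℝ) / 2) :=
    hD (Metric.mem_closedBall_self hr.le)
  have hsup := le_supNorm_ball hr ((continuousOn_dphi q hL).mono hD)
  rw [dphi_eq q hL hcmem] at hsup
  set S := supNorm (Metric.ball c (radiusD n₀ (n₀ + n') ε₂)) (dphi q L)
  set y := stickVariance q L (phi q L m) with hydef
  set yc := stickVariance q L (phi q L c) with hyc
  have hy0 : 0 < y := stickVariance_pos q hL _
  have hyc0 : 0 < yc := stickVariance_pos q hL _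
  have hcm : c - m = m * (n₀ / n') := by
    rw [hc, centerD, hsub]
    push_cast
    field_simp
    ring
  have hyle : yc ≤ y * ((|m| + N) ^ 2 * (n₀ : ℝ) ^ 2) := by
    have h3 := stickVariance_sub_le q L (phi q L m) (phi q L c)
    rw [phiInv_phi q hL hm, phiInv_phi q hL hcmem, hcm, abs_mul,
      abs_of_nonneg (show (0 : ℝ) ≤ n₀ / n' by positivity)] at h3
    have h4 : (n₀ : ℝ) / n' ≤ 2 * y * (n₀ : ℝ) ^ 2 := by
      rw [div_le_iff₀ (by linarith)]
      nlinarith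
    have h5 := mul_le_mul_of_nonneg_left h4 (abs_nonneg m)
    have h6 : 1 + 2 * |m| ≤ (|m| + N) ^ 2 := by nlinarith [abs_nonneg m]
    have h7 : (1 : ℝ) ≤ (n₀ : ℝ) ^ 2 := one_le_pow₀ h1
    have h8 := mul_le_mul_of_nonneg_left
      (mul_le_mul_of_nonneg_right h6 (sq_nonneg (n₀ : ℝ))) hy0.le
    nlinarith
  rw [hsub]
  have h9 : 1 / (2 * (n' * y)) ≤ 1 / 2 * S * ((|m| + N) ^ 2 * (n₀ : ℝ) ^ 2 / n') := by
    calc 1 / (2 * (n' * y)) ≤ 1 / 2 * yc⁻¹ * ((|m| + N) ^ 2 * (n₀ : ℝ) ^ 2 / n') := by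
          rw [show 1 / 2 * yc⁻¹ * ((|m| + N) ^ 2 * (n₀ : ℝ) ^ 2 / n')
            = ((|m| + N) ^ 2 * (n₀ : ℝ) ^ 2) / (2 * (n' * yc)) by field_simp,
            div_le_div_iff₀ (by positivity) (by positivity)]
          nlinarith [mul_le_mul_of_nonneg_left hyle (show (0 : ℝ) ≤ 2 * n' by positivity)]
      _ ≤ _ := by gcongr
  linarith [Real.add_one_le_exp (1 / 2 * S * ((|m| + N) ^ 2 * (n₀ : ℝ) ^ 2 / n'))]


theorem norm_canExp_sub_gcExp_le_error (q : ℝ) (hq0 : 0 < q) (hq1 : q < 1) (L n₀ n : ℕ) (hn : n₀ < n)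
    (X : Obs L n₀) (hX : Commute X (totalSpin L n₀))
    (m : ℝ) (hm : ∃ k : ℕ, k ≤ L * n ∧ m = -((L : ℝ) / 2) + (k : ℝ) / (n : ℝ))
    (ε : ℝ) (hε1 : ε < 1 / 4)
    (ε₂ : ℝ) (hε₂0 : 0 < ε₂)
    (hD : Metric.closedBall (centerD n₀ n m) (radiusD n₀ n ε₂)
      ⊆ Set.Ioo (-((L : ℝ) / 2)) ((L : ℝ) / 2))
    (hgeom : Real.exp |phi q L m| * q ^ (2 * (n : ℝ) ^ ε₂) < 1)
    (hlow : epsLower q L n ε m < 1) :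
    ‖canExp q hn.le (m * n) X - gcExp q (Real.exp (phi q L m / 2)) X‖
      ≤ 2 * (E₁ q L n₀ n m ε₂ + E₂ q L n₀ n m ε ε₂) * ‖X‖ := by
  obtain ⟨n', rfl⟩ := Nat.exists_eq_add_of_le hn.le
  have hn' : 0 < n' := by omega
  have hn'0 : (0 : ℝ) < n' := by exact_mod_cast hn'
  have hsub : ((n₀ + n' : ℕ) : ℝ) - n₀ = n' := by push_cast; ring
  have hNpos : (0 : ℝ) < ((n₀ + n' : ℕ) : ℝ) := by exact_mod_cast (by omega : 0 < n₀ + n')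
  have hc : centerD n₀ (n₀ + n') m ∈ Set.Ioo (-((L : ℝ) / 2)) ((L : ℝ) / 2) := by
    refine hD (Metric.mem_closedBall_self ?_)
    rw [radiusD, hsub]
    positivity
  have hL : 0 < L := by
    rcases Nat.eq_zero_or_pos L with h | h
    · subst h
      simp at hc
    · exact h
  have hmem : m ∈ Set.Ioo (-((L : ℝ) / 2)) ((L : ℝ) / 2) := by
    have h1 : |centerD n₀ (n₀ + n') m| < (L : ℝ) / 2 := abs_lt.2 ⟨hc.1, hc.2⟩
    have h2 : |m| ≤ |centerD n₀ (n₀ + n') m| := by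
      rw [centerD, hsub, abs_div, abs_mul, abs_of_pos hNpos, abs_of_pos hn'0, le_div_iff₀ hn'0]
      push_cast
      nlinarith [mul_nonneg (abs_nonneg m) (Nat.cast_nonneg (α := ℝ) n₀)]
    exact abs_lt.1 (h2.trans_lt h1)
  set t := phi q L m with ht
  set y := stickVariance q L t with hydef
  have hy0 : 0 < y := stickVariance_pos q hL t
  have hφ : dphi q L m = y⁻¹ := dphi_eq q hL hmem
  have hφ0 : 0 < dphi q L m := by rw [hφ]; positivity
  have hE₁ := E₁_nonneg hq0 hq1 L n₀ (n₀ + n') hgeom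
  have hA1 := one_le_upperFactor (ε₂ := ε₂) hn hφ0 hlow
  have hAE := upperFactor_le q L n₀ (n₀ + n') m ε ε₂
  have hexists : ∃ τ : Config L (n₀ + n'), ∑ x, spin (τ x) = m * ((n₀ + n' : ℕ) : ℝ) := by
    obtain ⟨k, hk, hmk⟩ := hm
    obtain ⟨σ, hσ⟩ := exists_magnetization_eq hk
    refine ⟨σ, hσ.trans ?_⟩
    rw [hmk]
    field_simp
    ring
  have hmean : 1 / 2 * ∑ x : Site L (n₀ + n'), polarization q L t x.1
      = m * ((n₀ + n' : ℕ) : ℝ) := by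
    rw [mean_site, phiInv_phi q hL hmem]
  have hpos : 0 < spinLaw (fun x : Site L (n₀ + n') => polarization q L t x.1)
      (m * ((n₀ + n' : ℕ) : ℝ)) :=
    spinLaw_pos (μ := fun x : Site L (n₀ + n') => polarization q L t x.1)
      (fun x => polarization_sq_lt_one q L t x.1) hexists
  refine norm_canExp_sub_gcExp_le hq0 hn.le hX t _ (by linarith) hpos fun k hk => ?_
  have hgoal : 1 + (E₁ q L n₀ (n₀ + n') m ε₂ + E₂ q L n₀ (n₀ + n') m ε ε₂)
      ≥ upperFactor q L n₀ (n₀ + n') m ε ε₂ := by linarith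
  refine le_trans ?_ (mul_le_mul_of_nonneg_right hgoal hpos.le)
  -- For `n₀ = 0` the ball `𝒟` is empty and its norms carry no information, but the two laws
  -- coincide and a factor at least `1` suffices.
  rcases Nat.eq_zero_or_pos n₀ with h0 | hn₀
  · subst h0
    have hk0 : k = 0 := by simpa using hk
    -- `0 + n'` and `n'` index different site types, so the equality is transported through a
    -- general `N`.
    have heq : ∀ N : ℕ, N = n' → ∀ M, spinLaw (fun x : Site L N => polarization q L t x.1) M
        = spinLaw (fun x : Site L n' => polarization q L t x.1) M := by
      rintro N rfl M
      rfl
    rw [heq (0 + n') (zero_add n')] at hpos ⊢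
    have hM : m * ((0 + n' : ℕ) : ℝ) - ((k : ℝ) - (L * (0 : ℕ) : ℝ) / 2)
        = m * ((0 + n' : ℕ) : ℝ) := by
      rw [hk0]
      simp
    rw [hM]
    exact le_mul_of_one_le_left hpos.le hA1
  · set P := spinLaw (fun x : Site L (n₀ + n') => polarization q L t x.1)
      (m * ((n₀ + n' : ℕ) : ℝ)) with hP
    set d := ((n₀ + n' : ℕ) : ℝ) ^ (-1 + 2 * ε) with hd
    have hd0 : 0 < d := by positivity
    have hd1 : d ≤ 0.708 := rpow_le_of_two_le (by omega) hε1
    have heps := le_epsLower (by omega : 0 < n₀ + n') hφ hd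
    have hVar : spinVariance (fun x : Site L (n₀ + n') => polarization q L t x.1)
        = ((n₀ + n' : ℕ) : ℝ) * y := spinVariance_site q L (n₀ + n') t
    have hlower := spinLaw_lower (μ := fun x : Site L (n₀ + n') => polarization q L t x.1)
      (fun x => (polarization_sq_lt_one q L t x.1).le) (by rw [hVar]; positivity)
      (by rw [hmean]; exact hexists) (Real.sqrt_pos.2 hd0) (by rw [Real.sq_sqrt hd0.le]; exact hd1)
    rw [hmean, hVar, Real.sq_sqrt hd0.le, ← hP] at hlower
    have hw := le_variance_of_lt_one hd0 (by linarith) (by positivity) (heps.trans_lt hlow)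
    have hvar := one_le_stickVariance_mul hn₀ hn' hε1 hw
    have hexp := one_add_le_exp_supNorm hL hn₀ hn' hmem hε₂0 hD hvar
    have hVar' : spinVariance (fun x : Site L n' => polarization q L t x.1) = n' * y :=
      spinVariance_site q L n' t
    have hupper := spinLaw_upper (fun x : Site L n' => polarization q L t x.1)
      (by rw [hVar']; positivity)
      (m * ((n₀ + n' : ℕ) : ℝ) - ((k : ℝ) - (L * n₀ : ℝ) / 2))
    rw [hVar'] at hupper
    have hfac := le_upperFactor (ε₂ := ε₂) hn hφ0 hlow
    refine le_trans ?_ (mul_le_mul_of_nonneg_right hfac hpos.le)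
    -- Both variances use the same `t`, so their quotient is just `(n₀ + n') / n'`.
    have hratio : √(2 * Real.pi * (((n₀ + n' : ℕ) : ℝ) * y))
        = √(1 + n₀ / (((n₀ + n' : ℕ) : ℝ) - n₀)) * √(2 * Real.pi * (n' * y)) := by
      rw [hsub, ← Real.sqrt_mul (by positivity)]
      congr 1
      push_cast
      field_simp
      ring
    have hs : 0 < √(2 * Real.pi * (n' * y)) := Real.sqrt_pos.2 (by positivity)
    rw [← le_div_iff₀ hs] at hupper
    refine hupper.trans ?_
    rw [div_le_iff₀ hs, div_mul_eq_mul_div, div_mul_eq_mul_div, le_div_iff₀ (sub_pos.2 hlow)]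
    have hlow2 : 1 - epsLower q L (n₀ + n') ε m
        ≤ P * (√(1 + n₀ / (((n₀ + n' : ℕ) : ℝ) - n₀)) * √(2 * Real.pi * (n' * y))) := by
      rw [← hratio]
      linarith
    refine (mul_le_mul hexp hlow2 (sub_pos.2 hlow).le (Real.exp_pos _).le).trans (le_of_eq ?_)
    ring

end XXZ

end

theorem mainTheorem9 (q : ℝ) (hq0 : 0 < q) (hq1 : q < 1) (L n₀ n : ℕ) (hn : n₀ < n)
    (X : XXZ.Obs L n₀) (hX : Commute X (XXZ.totalSpin L n₀))
    (m : ℝ) (hm : ∃ k : ℕ, k ≤ L * n ∧ m = -((L : ℝ) / 2) + (k : ℝ) / (n : ℝ))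
    (ε : ℝ) (hε0 : 0 < ε) (hε1 : ε < 1 / 4)
    (ε₂ : ℝ) (hε₂0 : 0 < ε₂) (hε₂1 : ε₂ < 1 / 2)
    (hD : Metric.closedBall (XXZ.centerD n₀ n m) (XXZ.radiusD n₀ n ε₂)
      ⊆ Set.Ioo (-((L : ℝ) / 2)) ((L : ℝ) / 2))
    (hgeom : Real.exp |XXZ.phi q L m| * q ^ (2 * (n : ℝ) ^ ε₂) < 1)
    (hlow : XXZ.epsLower q L n ε m < 1) :
    ‖XXZ.canExp q hn.le (m * n) X - XXZ.gcExp q (Real.exp (XXZ.phi q L m / 2)) X‖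
      ≤ 2 * (XXZ.E₁ q L n₀ n m ε₂ + XXZ.E₂ q L n₀ n m ε ε₂) * ‖X‖ :=
  XXZ.norm_canExp_sub_gcExp_le_error q hq0 hq1 L n₀ n hn X hX m hm ε hε1 ε₂ hε₂0 hD
    hgeom hlow
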